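/- For an integer $K\ge 1$ consider the random two-player game in which each player has strategy set $[K]=\{1,\dots,K\}$ and the $2K^2$ payoffs $Z_i^{\boldsymbol s}$ ($i\in\{1,2\}$, $\boldsymbol s\in[K]^2$) are i.i.d. with a continuous (atomless) distribution. Write $\boldsymbol t\sim_i\boldsymbol s$ if the profiles $\boldsymbol s,\boldsymbol t$ differ in the strategy of player $i$ and only there. Let $\mathcal P^{(i)}_{\boldsymbol s}=\{\boldsymbol t\sim_i\boldsymbol s: Z_i^{\boldsymbol t}\ge Z_i^{\boldsymbol s}\}$ and $\mathcal M^{(i)}_{\boldsymbol s}=\{\boldsymbol t\in\mathcal P^{(i)}_{\boldsymbol s}: Z_i^{\boldsymbol t}\ge Z_i^{\boldsymbol u}\text{ for all }\boldsymbol u\sim_i\boldsymbol s\}$ be the sets of better responses and of best responses of player $i$ at $\boldsymbol s$, and let $\mathcal E_K$ be the set of pure Nash equilibria, i.e. of profiles $\boldsymbol s$ with $Z_i^{\boldsymbol s}\ge Z_i^{\boldsymbol t}$ for all $i$ and all $\boldsymbol t\sim_i\boldsymbol s$. The better-response dynamics $\mathsf{bRD}$ is the process on $[K]^2$ with $\mathsf{bRD}(0)=(1,1)$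 which, at each time $n+1$, picks a player $I\in\{1,2\}$ uniformly at random, independently of the payoffs and the past, and moves to a uniformly random element of $\mathcal P^{(I)}_{\mathsf{bRD}(n)}$; if this set is empty the other player is used instead, and if the sets of both players are empty the process stays where it is. The best-response dynamics $\mathsf{BRD}$ is defined in the same way with $\mathcal M^{(i)}$ in place of $\mathcal P^{(i)}$. Each process is said to converge if it reaches a profile at which the corresponding sets of both players are empty. Probabilities are over the payoffs and the random choices of the process. (1) $\lim_{K\to\infty}\mathbb P(\mathsf{BRD}\text{ does not converge})=1$; in fact $\mathbb P(\mathsf{BRD}\text{ converges})\le \frac1K+\sqrt{\frac{\pi}{K}}$ for every $K\ge1$. (2) There is an absolute constant $C$ such that $\left|\mathbb P(\mathsf{bRD}\text{ converges})-(1-e^{-1})\right|\le C/K$ for every $K\ge1$; moreover $\mathbb P(\mathsf{bRD}\text{ converges}\mid\mathcal E_K\ne\varnothing)\to1$ as $K\to\infty$. -/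

import Mathlib

open MeasureTheory ProbabilityTheory Filter Topology

/-- A strategy profile of the two-player game in which each player has `K` strategies:
player `i : Fin 2` plays `s i : Fin K`. -/
abbrev Profile (K : ℕ) : Type := Fin 2 → Fin K

/-- A payoff array: `z i s` is the payoff of player `i` at the profile `s`. -/
abbrev Payoffs (K : ℕ) : Type := Fin 2 → Profile K → ℝ

/-- `s ∼ᵢ t`: the two profiles differ in the strategy of player `i` and only there. -/
def Neighbor {K : ℕ} (i : Fin 2) (s t : Profile K) : Prop :=
  s i ≠ t i ∧ ∀ j, j ≠ i → s j = t j

/-- `s` is a pure Nash equilibrium of the game with payoffs `z`. -/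
def IsPNE {K : ℕ} (z : Payoffs K) (s : Profile K) : Prop :=
  ∀ i, ∀ t, Neighbor i s t → z i t ≤ z i s

open Classical in
/-- The better responses of player `i` at the profile `s`. -/
noncomputable def betterResponses {K : ℕ} (z : Payoffs K) (i : Fin 2) (s : Profile K) :
    Finset (Profile K) :=
  Finset.univ.filter fun t => Neighbor i t s ∧ z i s ≤ z i t

open Classical in
/-- The best responses of player `i` at the profile `s`: those better responses whose payoff is
maximal among all profiles that `i` can move to. -/
noncomputable def bestResponses {K : ℕ} (z : Payoffs K) (i : Fin 2) (s : Profile K) :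
    Finset (Profile K) :=
  (betterResponses z i s).filter fun t => ∀ u, Neighbor i u s → z i u ≤ z i t

open Classical in
/-- One step from `s`, when `A i` is the set of allowed moves of player `i`: pick a player `i`
uniformly at random and move to a uniformly chosen element of `A i`; if `A i` is empty, use
the other player `1 - i` instead; if both sets are empty, stay at `s`. -/
noncomputable def stepLaw {K : ℕ} (A : Fin 2 → Finset (Profile K)) (s : Profile K) :
    PMF (Profile K) :=
  (PMF.uniformOfFintype (Fin 2)).bind fun i =>
    if h : (A i).Nonempty then PMF.uniformOfFinset (A i) h
    else if h' : (A (1 - i)).Nonempty then PMF.uniformOfFinset (A (1 - i)) h'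
    else PMF.pure s

/-- The random payoffs `Z` (`2 K²` real random variables) are i.i.d. with a continuous
distribution, that is, a distribution without atoms. -/
structure IsRandomGame {Ω : Type*} [MeasurableSpace Ω] {K : ℕ} (μ : Measure Ω)
    (Z : Ω → Payoffs K) : Prop where
  measurable : ∀ i s, Measurable fun ω => Z ω i s
  indep : iIndepFun (fun (p : Fin 2 × Profile K) ω => Z ω p.1 p.2) μ
  identDistrib : ∀ i s j t, IdentDistrib (fun ω => Z ω i s) (fun ω => Z ω j t) μ μ
  noAtoms : ∀ i s (x : ℝ), μ {ω | Z ω i s = x} = 0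

/-- `X` is the response dynamics in the random game `Z`, with `R z i s` the set of allowed moves
of player `i` at `s` when the payoffs are `z`: it starts at the profile where both players
play their first strategy, and, given the payoffs `Z` and the past `X 0, …, X n`, its next
position has the law `stepLaw` at the current position. The conditional law is expressed by
integrating over the events `{Z ∈ B, X 0 = x 0, …, X n = x n}`. -/
structure IsResponseDynamics {Ω : Type*} [MeasurableSpace Ω] {K : ℕ} [NeZero K]
    (R : Payoffs K → Fin 2 → Profile K → Finset (Profile K)) (μ : Measure Ω)
    (Z : Ω → Payoffs K) (X : ℕ → Ω → Profile K) : Prop where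
  measurable : ∀ n, Measurable (X n)
  start : ∀ᵐ ω ∂μ, X 0 ω = fun _ => 0
  step : ∀ (n : ℕ) (B : Set (Payoffs K)), MeasurableSet B →
    ∀ (x : ℕ → Profile K) (t : Profile K),
      μ {ω | Z ω ∈ B ∧ (∀ k ≤ n, X k ω = x k) ∧ X (n + 1) ω = t} =
        ∫⁻ ω in {ω | Z ω ∈ B ∧ ∀ k ≤ n, X k ω = x k},
          stepLaw (fun i => R (Z ω) i (x n)) (x n) t ∂μ

/-- The event that the dynamics `X` with allowed moves `R` converges: at some time it reaches a
profile at which neither player has an allowed move. -/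
def convergenceEvent {Ω : Type*} {K : ℕ}
    (R : Payoffs K → Fin 2 → Profile K → Finset (Profile K))
    (Z : Ω → Payoffs K) (X : ℕ → Ω → Profile K) : Set Ω :=
  {ω | ∃ n, ∀ i, R (Z ω) i (X n ω) = ∅}

/-- The event that the game has a pure Nash equilibrium. -/
def pneEvent {Ω : Type*} {K : ℕ} (Z : Ω → Payoffs K) : Set Ω :=
  {ω | ∃ s, IsPNE (Z ω) s}

/-!
Given the payoffs, both dynamics are finite Markov chains, so that the probability of convergence
is the mean over the payoffs of an absorption probability
(`IsResponseDynamics.measure_convergence`). The payoffs split into `2 * K` independent blocks, one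
for each player and each strategy of the opponent; a block is an i.i.d. vector without ties, in
which all ranks of a given coordinate are equally likely (`IsRandomGame.blocks`,
`measureReal_card_above_le`). In particular the best replies are independent and uniform.

*Best responses.* After the first move, best-response dynamics alternates between the players and
is the iteration of the uniformly random bipartite mapping "best reply". It converges if and only
if this iteration ends in a cycle of length two. Revealing the mapping along its path, the path
turns back at each step with probability `1 / K`, while the probability that it has not closed up
after `n` steps is at most `exp (-⌊n² / 4⌋ / K)` (`card_freshMaps_le`). Comparing the sum over `n`
with a Gaussian integral gives the bound (`IsRandomGame.measureReal_endsInPair_le`).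

*Existence of equilibria.* Given the best replies of one player, those of the other one are
independent, so that there is no equilibrium with conditional probability `∏ (1 - n_b / K)`, where
`∑ n_b = K`. This is `1 / e` up to `∑ (n_b / K)²`, which has mean of order `1 / K`
(`IsRandomGame.measureReal_compl_pneEvent`).

*Better responses.* They can only converge to an equilibrium. Conversely they converge almost
surely if from every profile an equilibrium can be reached. If there is an equilibrium `(a₀, b₀)`
and this fails, then from some profile neither the row `a₀` nor the column `b₀` can be reached. By
best replies from such a profile one meets, twice in a row, a nonempty set of improvements, each of
which has to miss the row and the column as well as all moves to them (`exists_isTrap`). As the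
number of improvements is uniform, this has probability of order `K⁻²`, which after summation over
the `K` possible rows of departure leaves a probability of order `1 / K`
(`IsRandomGame.measureReal_exists_isTrap_le`).
-/

open scoped ENNReal

/-! ### The dynamics given the payoffs -/

/-- The law after `n` steps of the chain started at `s` in which the sets of allowed moves are
fixed to be `A i t` (player `i` at the profile `t`). -/
noncomputable def walkLaw {K : ℕ} (A : Fin 2 → Profile K → Finset (Profile K)) (s : Profile K) :
    ℕ → PMF (Profile K)
  | 0 => PMF.pure s
  | n + 1 => (walkLaw A s n).bind fun t => stepLaw (fun i => A i t) t

lemma walkLaw_succ' {K : ℕ} (A : Fin 2 → Profile K → Finset (Profile K)) (s : Profile K) (n : ℕ) :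
    walkLaw A s (n + 1) = (stepLaw (fun i => A i s) s).bind fun t => walkLaw A t n := by
  induction n with
  | zero => simp [walkLaw]
  | succ n ih =>
    rw [walkLaw, ih, PMF.bind_bind]
    rfl

open Classical in
/-- The probability that the chain with allowed moves `A`, started at `s`, sits after `n` steps at
a profile where nobody has an allowed move. -/
noncomputable def absorbedProb {K : ℕ} (A : Fin 2 → Profile K → Finset (Profile K))
    (s : Profile K) (n : ℕ) : ℝ≥0∞ :=
  ∑ t with ∀ i, A i t = ∅, walkLaw A s n t

open Classical in
lemma absorbedProb_zero {K : ℕ} (A : Fin 2 → Profile K → Finset (Profile K))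
    (s : Profile K) : absorbedProb A s 0 = if ∀ i, A i s = ∅ then 1 else 0 := by
  rw [absorbedProb, Finset.sum_filter, Finset.sum_eq_single s]
  · simp [walkLaw]
  · intro t _ ht
    simp [walkLaw, PMF.pure_apply, ht]
  · simp

lemma absorbedProb_succ {K : ℕ} (A : Fin 2 → Profile K → Finset (Profile K))
    (s : Profile K) (n : ℕ) :
    absorbedProb A s (n + 1) = ∑ t, stepLaw (fun i => A i s) s t * absorbedProb A t n := by
  simp only [absorbedProb, walkLaw_succ', PMF.bind_apply, tsum_fintype, Finset.mul_sum]
  exact Finset.sum_comm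

lemma absorbedProb_le_one {K : ℕ} (A : Fin 2 → Profile K → Finset (Profile K))
    (s : Profile K) (n : ℕ) : absorbedProb A s n ≤ 1 := by
  rw [← (walkLaw A s n).tsum_coe, tsum_fintype]
  exact Finset.sum_le_sum_of_subset (Finset.subset_univ _)

lemma measure_eq_sum_inter_fiber {Ω β : Type*} [MeasurableSpace Ω] [Fintype β] [MeasurableSpace β]
    [MeasurableSingletonClass β] (μ : Measure Ω) {H : Ω → β} (hH : Measurable H) (E : Set Ω) :
    μ E = ∑ b, μ (E ∩ H ⁻¹' {b}) := by
  have h := sum_measure_preimage_singleton (μ := μ.restrict E) Finset.univ (f := H)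
    fun y _ => hH (measurableSet_singleton y)
  simp only [Finset.coe_univ, Set.preimage_univ, Measure.restrict_apply_univ] at h
  rw [← h]
  refine Finset.sum_congr rfl fun b _ => ?_
  rw [Measure.restrict_apply (hH (measurableSet_singleton b)), Set.inter_comm]

lemma stepLaw_of_isEmpty {K : ℕ} {A : Fin 2 → Finset (Profile K)} {s : Profile K}
    (h : ∀ i, A i = ∅) : stepLaw A s = PMF.pure s := by
  simp [stepLaw, h]

section Dynamics

variable {Ω : Type*} [MeasurableSpace Ω] {K : ℕ} [NeZero K]
  {R : Payoffs K → Fin 2 → Profile K → Finset (Profile K)} {μ : Measure Ω}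
  {Z : Ω → Payoffs K} {X : ℕ → Ω → Profile K}

/-- On a set `B` of payoffs on which the allowed moves do not vary, the dynamics is a Markov
chain. -/
lemma IsResponseDynamics.measure_step (h : IsResponseDynamics R μ Z X) {B : Set (Payoffs K)}
    (hB : MeasurableSet B) (hZ : Measurable Z) {A : Fin 2 → Profile K → Finset (Profile K)}
    (hA : ∀ z ∈ B, R z = A) (n : ℕ) (s t : Profile K) :
    μ {ω | Z ω ∈ B ∧ X n ω = s ∧ X (n + 1) ω = t} =
      μ {ω | Z ω ∈ B ∧ X n ω = s} * stepLaw (fun i => A i s) s t := by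
  classical
  have hm : Measurable fun ω (k : Fin (n + 1)) => X k ω :=
    measurable_pi_lambda _ fun k => h.measurable k
  rw [measure_eq_sum_inter_fiber μ hm, measure_eq_sum_inter_fiber μ hm {ω | Z ω ∈ B ∧ X n ω = s},
    Finset.sum_mul]
  refine Finset.sum_congr rfl fun b _ => ?_
  by_cases hb : b (Fin.last n) = s
  · let x : ℕ → Profile K := fun k => if hk : k < n + 1 then b ⟨k, hk⟩ else s
    have hxn : x n = s := (dif_pos n.lt_succ_self).trans hb
    have hx : ∀ ω, (∀ k ≤ n, X k ω = x k) ↔ (fun k : Fin (n + 1) => X k ω) = b := by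
      intro ω
      constructor
      · intro hω
        ext1 k
        exact (hω k (Nat.lt_succ_iff.1 k.2)).trans (dif_pos k.2)
      · rintro rfl k hk
        exact (dif_pos (Nat.lt_succ_iff.2 hk) : x k = X k ω).symm
    have h1 : {ω | Z ω ∈ B ∧ X n ω = s ∧ X (n + 1) ω = t} ∩
        (fun ω (k : Fin (n + 1)) => X k ω) ⁻¹' {b} =
        {ω | Z ω ∈ B ∧ (∀ k ≤ n, X k ω = x k) ∧ X (n + 1) ω = t} := by
      ext ω
      simp only [Set.mem_inter_iff, Set.mem_ofPred_eq, Set.mem_preimage, Set.mem_singleton_iff,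
        ← hx ω]
      constructor
      · tauto
      · rintro ⟨h1, h2, h3⟩
        exact ⟨⟨h1, (h2 n le_rfl).trans hxn, h3⟩, h2⟩
    have h2 : {ω | Z ω ∈ B ∧ X n ω = s} ∩ (fun ω (k : Fin (n + 1)) => X k ω) ⁻¹' {b} =
        {ω | Z ω ∈ B ∧ (∀ k ≤ n, X k ω = x k)} := by
      ext ω
      simp only [Set.mem_inter_iff, Set.mem_ofPred_eq, Set.mem_preimage, Set.mem_singleton_iff,
        ← hx ω]
      constructor
      · tauto
      · rintro ⟨h1, h2⟩
        exact ⟨⟨h1, (h2 n le_rfl).trans hxn⟩, h2⟩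
    have hmeas : MeasurableSet {ω | Z ω ∈ B ∧ ∀ k ≤ n, X k ω = x k} := by
      refine (hZ hB).inter (s₂ := {ω | ∀ k ≤ n, X k ω = x k}) ?_
      simp only [Set.ofPred_forall]
      exact MeasurableSet.iInter fun k => MeasurableSet.iInter fun _ =>
        h.measurable k (measurableSet_singleton (x k))
    rw [h1, h2, h.step n B hB x t, setLIntegral_congr_fun hmeas
      (g := fun _ => stepLaw (fun i => A i s) s t), setLIntegral_const, mul_comm]
    intro ω hω
    simp only [hA _ hω.1, hxn]
  · have h0 : {ω | Z ω ∈ B ∧ X n ω = s} ∩ (fun ω (k : Fin (n + 1)) => X k ω) ⁻¹' {b} = ∅ := by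
      ext ω
      simp only [Set.mem_inter_iff, Set.mem_ofPred_eq, Set.mem_preimage, Set.mem_singleton_iff,
        Set.mem_empty_iff_false, iff_false, not_and]
      rintro ⟨_, h1⟩ rfl
      exact hb h1
    rw [h0, measure_empty, zero_mul]
    exact measure_mono_null (fun ω hω => h0.subset ⟨⟨hω.1.1, hω.1.2.1⟩, hω.2⟩) measure_empty

lemma IsResponseDynamics.measure_eq (h : IsResponseDynamics R μ Z X) {B : Set (Payoffs K)}
    (hB : MeasurableSet B) (hZ : Measurable Z) {A : Fin 2 → Profile K → Finset (Profile K)}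
    (hA : ∀ z ∈ B, R z = A) (n : ℕ) (t : Profile K) :
    μ {ω | Z ω ∈ B ∧ X n ω = t} = μ (Z ⁻¹' B) * walkLaw A (fun _ => 0) n t := by
  classical
  induction n generalizing t with
  | zero =>
    simp only [walkLaw, PMF.pure_apply]
    split_ifs with ht
    · rw [mul_one]
      refine measure_congr ?_
      filter_upwards [h.start] with ω hω
      exact propext ⟨fun hh => hh.1, fun hh => ⟨hh, hω.trans ht.symm⟩⟩
    · rw [mul_zero]
      refine measure_mono_null (t := {ω | ¬ X 0 ω = fun _ => 0}) (fun ω hω => ?_)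
        (ae_iff.1 h.start)
      exact fun hh => ht (hω.2.symm.trans hh)
  | succ n ih =>
    rw [measure_eq_sum_inter_fiber μ (h.measurable n)]
    simp only [walkLaw, PMF.bind_apply, tsum_fintype, Finset.mul_sum, ← mul_assoc, ← ih]
    refine Finset.sum_congr rfl fun s _ => ?_
    rw [← h.measure_step hB hZ hA]
    congr 1
    ext ω
    simp only [Set.mem_inter_iff, Set.mem_ofPred_eq, Set.mem_preimage, Set.mem_singleton_iff]
    tauto

lemma IsResponseDynamics.measure_convergence_inter (h : IsResponseDynamics R μ Z X)
    {B : Set (Payoffs K)} (hB : MeasurableSet B) (hZ : Measurable Z)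
    {A : Fin 2 → Profile K → Finset (Profile K)} (hA : ∀ z ∈ B, R z = A) :
    μ (convergenceEvent R Z X ∩ Z ⁻¹' B) =
      μ (Z ⁻¹' B) * ⨆ n, absorbedProb A (fun _ => 0) n := by
  classical
  let E : ℕ → Set Ω := fun n => {ω | Z ω ∈ B ∧ ∀ i, A i (X n ω) = ∅}
  have hE : ∀ n, μ (E n) = μ (Z ⁻¹' B) * absorbedProb A (fun _ => 0) n := by
    intro n
    rw [measure_eq_sum_inter_fiber μ (h.measurable n), absorbedProb, Finset.sum_filter,
      Finset.mul_sum]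
    refine Finset.sum_congr rfl fun s _ => ?_
    split_ifs with hs
    · rw [← h.measure_eq hB hZ hA]
      congr 1
      ext ω
      simp only [Set.mem_inter_iff, Set.mem_ofPred_eq, Set.mem_preimage, Set.mem_singleton_iff, E]
      constructor
      · tauto
      · rintro ⟨h1, rfl⟩
        exact ⟨⟨h1, hs⟩, rfl⟩
    · rw [mul_zero]
      convert measure_empty (μ := μ)
      ext ω
      simp only [Set.mem_inter_iff, Set.mem_ofPred_eq, Set.mem_preimage, Set.mem_singleton_iff, E,
        Set.mem_empty_iff_false, iff_false, not_and]
      rintro ⟨_, h1⟩ rfl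
      exact hs h1
  -- once at an absorbing profile the dynamics almost surely stays there
  have hmono : ∀ n, E n ≤ᵐ[μ] E (n + 1) := by
    intro n
    have h0 : ∀ s t : Profile K, (∀ i, A i s = ∅) → s ≠ t →
        ∀ᵐ ω ∂μ, ¬ (Z ω ∈ B ∧ X n ω = s ∧ X (n + 1) ω = t) := by
      intro s t hs hst
      rw [ae_iff]
      simp only [not_not]
      rw [h.measure_step hB hZ hA, stepLaw_of_isEmpty hs]
      simp [PMF.pure_apply, hst.symm]
    have h1 : ∀ᵐ ω ∂μ, ∀ s t : Profile K, (∀ i, A i s = ∅) → s ≠ t →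
        ¬ (Z ω ∈ B ∧ X n ω = s ∧ X (n + 1) ω = t) := by
      rw [ae_all_iff]; intro s
      rw [ae_all_iff]; intro t
      by_cases hs : ∀ i, A i s = ∅
      · by_cases hst : s = t
        · simp [hst]
        · filter_upwards [h0 s t hs hst] with ω hω _ _ using hω
      · simp [hs]
    filter_upwards [h1] with ω hω hωE
    refine ⟨hωE.1, ?_⟩
    by_cases hst : X n ω = X (n + 1) ω
    · rw [← hst]; exact hωE.2
    · exact absurd ⟨hωE.1, rfl, rfl⟩ (hω _ _ hωE.2 hst)
  have hacc : ∀ n, Set.accumulate E n =ᵐ[μ] E n := by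
    intro n
    induction n with
    | zero =>
      simp only [Set.accumulate, Nat.le_zero_eq, Set.iUnion_iUnion_eq_left]
      exact ae_eq_refl _
    | succ n ih =>
      rw [Set.accumulate_succ]
      refine (ih.union (ae_eq_refl _)).trans ?_
      filter_upwards [hmono n] with ω hω
      exact propext ⟨fun hh => hh.elim hω id, Or.inr⟩
  have hconv : convergenceEvent R Z X ∩ Z ⁻¹' B = ⋃ n, E n := by
    ext ω
    simp only [convergenceEvent, Set.mem_inter_iff, Set.mem_ofPred_eq, Set.mem_preimage,
      Set.mem_iUnion, E]
    constructor
    · rintro ⟨⟨n, hn⟩, hω⟩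
      exact ⟨n, hω, by rwa [hA _ hω] at hn⟩
    · rintro ⟨n, hω, hn⟩
      exact ⟨⟨n, by rwa [hA _ hω]⟩, hω⟩
  rw [hconv, measure_iUnion_eq_iSup_accumulate, ENNReal.mul_iSup]
  exact iSup_congr fun n => (measure_congr (hacc n)).trans (hE n)

/-- The probability of convergence is the average over the payoffs of the absorption probability
of the chain with the payoffs frozen. -/
theorem IsResponseDynamics.measure_convergence (h : IsResponseDynamics R μ Z X)
    (hR : ∀ A, MeasurableSet {z | R z = A}) (hZ : Measurable Z) :
    μ (convergenceEvent R Z X) =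
      ∫⁻ ω, ⨆ n, absorbedProb (R (Z ω)) (fun _ => 0) n ∂μ := by
  classical
  let _ : MeasurableSpace (Fin 2 → Profile K → Finset (Profile K)) := ⊤
  have : MeasurableSingletonClass (Fin 2 → Profile K → Finset (Profile K)) :=
    ⟨fun _ => trivial⟩
  have hRm : Measurable fun ω => R (Z ω) := measurable_to_countable' fun A => hZ (hR A)
  rw [measure_eq_sum_inter_fiber μ hRm]
  have h1 : ∫⁻ ω, ⨆ n, absorbedProb (R (Z ω)) (fun _ => 0) n ∂μ =
      ∫⁻ A, (⨆ n, absorbedProb A (fun _ => 0) n) ∂(μ.map fun ω => R (Z ω)) :=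
    (lintegral_map (f := fun A => ⨆ n, absorbedProb A (fun _ => 0) n) measurable_from_top
      hRm).symm
  rw [h1, lintegral_fintype]
  refine Finset.sum_congr rfl fun A _ => ?_
  rw [Measure.map_apply hRm (measurableSet_singleton A), mul_comm]
  exact h.measure_convergence_inter (hR A) hZ fun z hz => hz

lemma IsResponseDynamics.measurableSet_convergenceEvent (h : IsResponseDynamics R μ Z X)
    (hR : ∀ A, MeasurableSet {z | R z = A}) (hZ : Measurable Z) :
    MeasurableSet (convergenceEvent R Z X) := by
  have : convergenceEvent R Z X = ⋃ (n : ℕ) (A : Fin 2 → Profile K → Finset (Profile K))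
      (s : Profile K) (_ : ∀ i, A i s = ∅), (Z ⁻¹' {z | R z = A}) ∩ (X n ⁻¹' {s}) := by
    ext ω
    simp only [convergenceEvent, Set.mem_ofPred_eq, Set.mem_iUnion, Set.mem_inter_iff,
      Set.mem_preimage, Set.mem_singleton_iff, exists_prop]
    constructor
    · rintro ⟨n, hn⟩
      exact ⟨n, _, _, hn, rfl, rfl⟩
    · rintro ⟨n, A, s, hn, rfl, rfl⟩
      exact ⟨n, hn⟩
  rw [this]
  exact MeasurableSet.iUnion fun n => MeasurableSet.iUnion fun A => MeasurableSet.iUnion fun s =>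
    MeasurableSet.iUnion fun _ => (hZ (hR A)).inter (h.measurable n (measurableSet_singleton s))

end Dynamics

/-! ### Absorption in a finite chain -/

section Absorption

variable {K : ℕ} {A : Fin 2 → Profile K → Finset (Profile K)}

lemma absorbedProb_le_succ (s : Profile K) (n : ℕ) :
    absorbedProb A s n ≤ absorbedProb A s (n + 1) := by
  induction n generalizing s with
  | zero =>
    rw [absorbedProb_zero]
    split_ifs with hs
    · rw [absorbedProb_succ, stepLaw_of_isEmpty hs, Finset.sum_eq_single s]
      · simp [absorbedProb_zero, hs]
      · intro t _ ht
        simp [PMF.pure_apply, ht]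
      · simp
    · exact zero_le
  | succ n ih =>
    rw [absorbedProb_succ, absorbedProb_succ _ s (n + 1)]
    gcongr
    exact ih _

lemma iSup_absorbedProb_eq_sum (s : Profile K) :
    ⨆ n, absorbedProb A s n =
      ∑ t, stepLaw (fun i => A i s) s t * ⨆ n, absorbedProb A t n := by
  have hm : ∀ t, Monotone fun n => absorbedProb A t n := fun t =>
    monotone_nat_of_le_succ (absorbedProb_le_succ t)
  simp only [ENNReal.mul_iSup]
  rw [← (hm s).iSup_nat_add 1, ENNReal.finsetSum_iSup_of_monotone]
  · simp only [absorbedProb_succ]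
  · intro t n m hnm
    dsimp only
    gcongr
    exact hm t hnm

lemma stepLaw_ne_zero {B : Fin 2 → Finset (Profile K)} {s t : Profile K} {i : Fin 2}
    (h : t ∈ B i) : stepLaw B s t ≠ 0 := by
  rw [← PMF.mem_support_iff, stepLaw, PMF.mem_support_bind_iff]
  refine ⟨i, by simp, ?_⟩
  rw [dif_pos ⟨t, h⟩]
  exact (PMF.mem_support_uniformOfFinset_iff _ _).2 h

/-- If an absorbing profile can be reached from everywhere, absorption is certain: the absorption
probability is harmonic, so that its minimum propagates along the allowed moves, to an absorbing
profile. -/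
lemma iSup_absorbedProb_eq_one
    (hA : ∀ s, ∃ t, Relation.ReflTransGen (fun s t => ∃ i, t ∈ A i s) s t ∧ ∀ i, A i t = ∅)
    (s : Profile K) : ⨆ n, absorbedProb A s n = 1 := by
  set h : Profile K → ℝ≥0∞ := fun s => ⨆ n, absorbedProb A s n with hh
  have hle : ∀ s, h s ≤ 1 := fun s => iSup_le fun n => absorbedProb_le_one A s n
  have : Nonempty (Profile K) := ⟨s⟩
  obtain ⟨m, hm⟩ := Finite.exists_min h
  have hstep : ∀ t u, h t = h m → (∃ i, u ∈ A i t) → h u = h m := by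
    rintro t u ht ⟨i, hu⟩
    refine le_antisymm (not_lt.1 fun hlt => ?_) (hm u)
    have hp : stepLaw (fun i => A i t) t u ≠ 0 := stepLaw_ne_zero (i := i) hu
    have hfin : h m ≠ ∞ := ((hle m).trans_lt ENNReal.one_lt_top).ne
    have h1 : h m = ∑ v, stepLaw (fun i => A i t) t v * h m := by
      rw [← Finset.sum_mul, ← tsum_fintype (L := .unconditional _), PMF.tsum_coe, one_mul]
    have h2 : h m = ∑ v, stepLaw (fun i => A i t) t v * h v := by
      rw [← ht]; exact iSup_absorbedProb_eq_sum t
    have h3 : ∑ v, stepLaw (fun i => A i t) t v * h m <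
        ∑ v, stepLaw (fun i => A i t) t v * h v := by
      rw [← Finset.add_sum_erase _ _ (Finset.mem_univ u),
        ← Finset.add_sum_erase (a := u) _ (fun v => _ * h v) (Finset.mem_univ u)]
      refine ENNReal.add_lt_add_of_lt_of_le ?_ ?_ ?_
      · refine ne_top_of_le_ne_top hfin ?_
        conv_rhs => rw [h1]
        exact Finset.sum_le_sum_of_subset (Finset.erase_subset _ _)
      · exact (ENNReal.mul_lt_mul_iff_right hp (PMF.apply_ne_top _ _)).2 hlt
      · gcongr
        exact hm _
    exact absurd (h1.symm.trans h2) h3.ne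
  obtain ⟨t, hmt, ht⟩ := hA m
  have hth : h t = h m := by
    clear ht
    induction hmt with
    | refl => rfl
    | tail _ hbc ih => exact hstep _ _ ih hbc
  have ht1 : h t = 1 := by
    refine le_antisymm (hle t) ?_
    refine le_trans ?_ (le_iSup _ 0)
    rw [absorbedProb_zero, if_pos ht]
  refine le_antisymm (hle s) ?_
  rw [← ht1, hth]
  exact hm s

end Absorption

/-! ### Profiles and replies -/

section Replies

variable {K : ℕ}

/-- The profile at which player `i` plays `y` and the other player plays `x`. -/
def replyProfile (i : Fin 2) (y x : Fin K) : Profile K := fun j => if j = i then y else x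

@[simp] lemma replyProfile_self (i : Fin 2) (y x : Fin K) : replyProfile i y x i = y := by
  simp [replyProfile]

@[simp] lemma replyProfile_other (i : Fin 2) (y x : Fin K) :
    replyProfile i y x (1 - i) = x := by
  fin_cases i <;> simp [replyProfile]

lemma eq_or_eq_one_sub (i j : Fin 2) : j = i ∨ j = 1 - i := by
  fin_cases i <;> fin_cases j <;> simp

lemma one_sub_ne (i : Fin 2) : 1 - i ≠ i := by
  fin_cases i <;> simp

lemma replyProfile_swap (i : Fin 2) (y x : Fin K) :
    replyProfile (1 - i) x y = replyProfile i y x := by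
  ext j
  fin_cases i <;> fin_cases j <;> simp [replyProfile]

@[simp] lemma replyProfile_eta (i : Fin 2) (s : Profile K) :
    replyProfile i (s i) (s (1 - i)) = s := by
  ext j
  fin_cases i <;> fin_cases j <;> simp [replyProfile]

lemma neighbor_iff {i : Fin 2} {s t : Profile K} :
    Neighbor i s t ↔ s i ≠ t i ∧ s (1 - i) = t (1 - i) := by
  refine and_congr_right fun _ => ⟨fun h => h _ (one_sub_ne i), fun h j hj => ?_⟩
  rcases eq_or_eq_one_sub i j with rfl | rfl
  · exact absurd rfl hj
  · exact h

/-- The payoffs that player `p.1` can get when the other player plays `p.2`, as a function of the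
own strategy. The `2 * K` blocks partition the payoffs. -/
def payoffBlock (z : Payoffs K) (p : Fin 2 × Fin K) : Fin K → ℝ :=
  fun y => z p.1 (replyProfile p.1 y p.2)

lemma payoffBlock_eq (z : Payoffs K) (i : Fin 2) (s : Profile K) :
    payoffBlock z (i, s (1 - i)) (s i) = z i s := by
  simp [payoffBlock]

/-- No player is indifferent between two replies. -/
def NoTies (z : Payoffs K) : Prop := ∀ p, Function.Injective (payoffBlock z p)

lemma mem_betterResponses {z : Payoffs K} {i : Fin 2} {s t : Profile K} :
    t ∈ betterResponses z i s ↔ (t i ≠ s i ∧ t (1 - i) = s (1 - i)) ∧ z i s ≤ z i t := by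
  simp [betterResponses, neighbor_iff]

lemma replyProfile_mem_betterResponses {z : Payoffs K} {i : Fin 2} {y w x : Fin K} :
    replyProfile i y x ∈ betterResponses z i (replyProfile i w x) ↔
      y ≠ w ∧ payoffBlock z (i, x) w ≤ payoffBlock z (i, x) y := by
  simp [mem_betterResponses, payoffBlock]

lemma isPNE_iff {z : Payoffs K} {s : Profile K} :
    IsPNE z s ↔ ∀ i y, payoffBlock z (i, s (1 - i)) y ≤ payoffBlock z (i, s (1 - i)) (s i) := by
  refine forall_congr' fun i => ⟨fun h y => ?_, fun h t ht => ?_⟩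
  · rw [payoffBlock_eq]
    by_cases hy : s i = y
    · rw [← hy, payoffBlock_eq]
    · exact h _ (neighbor_iff.2 ⟨by simpa using hy, by simp⟩)
  · rw [neighbor_iff] at ht
    have := h (t i)
    rwa [payoffBlock_eq, ht.2, payoffBlock_eq] at this

lemma IsPNE.betterResponses_eq_empty {z : Payoffs K} (hz : NoTies z) {s : Profile K}
    (hs : IsPNE z s) (i : Fin 2) : betterResponses z i s = ∅ := by
  rw [Finset.eq_empty_iff_forall_notMem]
  intro t ht
  rw [mem_betterResponses] at ht
  have h1 := hs i t (neighbor_iff.2 ⟨ht.1.1.symm, ht.1.2.symm⟩)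
  refine ht.1.1 (hz (i, s (1 - i)) ?_)
  rw [payoffBlock_eq, ← ht.1.2, payoffBlock_eq]
  exact le_antisymm h1 ht.2

lemma isPNE_of_betterResponses_eq_empty {z : Payoffs K} {s : Profile K}
    (hs : ∀ i, betterResponses z i s = ∅) : IsPNE z s := by
  intro i t ht
  by_contra! hlt
  rw [neighbor_iff] at ht
  have : t ∈ betterResponses z i s := mem_betterResponses.2 ⟨⟨ht.1.symm, ht.2.symm⟩, hlt.le⟩
  simp [hs i] at this

variable [NeZero K]

/-- A best reply of player `p.1` to the strategy `p.2` of the other player. -/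
noncomputable def bestReply (z : Payoffs K) (p : Fin 2 × Fin K) : Fin K :=
  (Finite.exists_max (payoffBlock z p)).choose

lemma le_bestReply (z : Payoffs K) (p : Fin 2 × Fin K) (y : Fin K) :
    payoffBlock z p y ≤ payoffBlock z p (bestReply z p) :=
  (Finite.exists_max (payoffBlock z p)).choose_spec y

lemma NoTies.eq_bestReply_iff {z : Payoffs K} (hz : NoTies z) {p : Fin 2 × Fin K} {y : Fin K} :
    bestReply z p = y ↔ ∀ x, payoffBlock z p x ≤ payoffBlock z p y :=
  ⟨fun h x => h ▸ le_bestReply z p x,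
    fun h => hz p (le_antisymm (h _) (le_bestReply z p y))⟩

lemma NoTies.isPNE_iff {z : Payoffs K} (hz : NoTies z) {s : Profile K} :
    IsPNE z s ↔ ∀ i, bestReply z (i, s (1 - i)) = s i := by
  simp only [_root_.isPNE_iff, hz.eq_bestReply_iff]

lemma NoTies.bestResponses_eq {z : Payoffs K} (hz : NoTies z) (i : Fin 2) (s : Profile K) :
    bestResponses z i s = if bestReply z (i, s (1 - i)) = s i then ∅ else
      {replyProfile i (bestReply z (i, s (1 - i))) (s (1 - i))} := by
  have key : ∀ t, t ∈ bestResponses z i s ↔ bestReply z (i, s (1 - i)) ≠ s i ∧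
      t = replyProfile i (bestReply z (i, s (1 - i))) (s (1 - i)) := by
    intro t
    simp only [bestResponses, Finset.mem_filter, mem_betterResponses]
    constructor
    · rintro ⟨⟨⟨h1, h2⟩, h3⟩, h4⟩
      have : bestReply z (i, s (1 - i)) = t i := by
        rw [hz.eq_bestReply_iff]
        intro x
        rw [← h2, payoffBlock_eq]
        by_cases hx : x = s i
        · rw [hx, h2, payoffBlock_eq]
          exact h3
        · refine h4 _ (neighbor_iff.2 ⟨by simpa using hx, ?_⟩)
          simp [h2]
      rw [this, ← h2]
      exact ⟨h1, by simp⟩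
    · rintro ⟨h1, rfl⟩
      refine ⟨⟨⟨by simpa using h1, by simp⟩, ?_⟩, fun u hu => ?_⟩
      · rw [← payoffBlock_eq z i s]
        simpa [payoffBlock] using le_bestReply z (i, s (1 - i)) (s i)
      · rw [← payoffBlock_eq z i u, (neighbor_iff.1 hu).2]
        exact le_bestReply z (i, s (1 - i)) _
  ext t
  rw [key]
  split_ifs with h <;> simp [h]

end Replies

/-! ### Better responses: traps -/

section Better

variable {K : ℕ}

/-- A configuration that is present as soon as `(a₀, b₀)` is an equilibrium and better responses
from some profile lead to no equilibrium at all. Here `(a, b)` is reached from that profile, with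
`b` the best reply to `a`, and so is `(α, b)`, with `α ≠ a` the best reply to `b`; no improvement of
player `0` on `(a, b)` and none of player `1` on `(α, b)` lies in the row `a₀` or in the column `b₀`
or allows a move there, since a further move would lead to `(a₀, b₀)`. -/
structure IsTrap (z : Payoffs K) (a₀ b₀ a b α : Fin K) : Prop where
  best_row : ∀ y, payoffBlock z (1, a₀) y ≤ payoffBlock z (1, a₀) b₀
  best_col : ∀ y, payoffBlock z (0, b₀) y ≤ payoffBlock z (0, b₀) a₀
  best_row' : ∀ y, payoffBlock z (1, a) y ≤ payoffBlock z (1, a) b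
  best_col' : ∀ y, payoffBlock z (0, b) y ≤ payoffBlock z (0, b) α
  lt : payoffBlock z (0, b) a < payoffBlock z (0, b) α
  ne_row : a ≠ a₀
  ne_col : b ≠ b₀
  avoid_col : ∀ y, payoffBlock z (0, b) a < payoffBlock z (0, b) y →
    y ≠ a₀ ∧ payoffBlock z (1, y) b₀ < payoffBlock z (1, y) b
  avoid_row : ∀ y, payoffBlock z (1, α) b < payoffBlock z (1, α) y →
    y ≠ b₀ ∧ payoffBlock z (0, y) a₀ < payoffBlock z (0, y) α

lemma isPNE_replyProfile_iff {z : Payoffs K} {a b : Fin K} :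
    IsPNE z (replyProfile 0 a b) ↔ (∀ y, payoffBlock z (0, b) y ≤ payoffBlock z (0, b) a) ∧
      ∀ y, payoffBlock z (1, a) y ≤ payoffBlock z (1, a) b := by
  rw [isPNE_iff, Fin.forall_fin_two]
  simp [replyProfile]

variable [NeZero K]

/-- If better responses from `s` lead to no equilibrium although there is one, there is a trap. -/
lemma exists_isTrap {z : Payoffs K} {a₀ b₀ : Fin K}
    (h₀ : IsPNE z (replyProfile 0 a₀ b₀)) {s : Profile K}
    (hs : ∀ t, Relation.ReflTransGen (fun s t => ∃ i, t ∈ betterResponses z i s) s t →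
      ¬ IsPNE z t) : ∃ a b α, IsTrap z a₀ b₀ a b α := by
  -- `C a b` says that the profile `(a, b)` can be reached
  set C : Fin K → Fin K → Prop := fun a b =>
    Relation.ReflTransGen (fun s t => ∃ i, t ∈ betterResponses z i s) s (replyProfile 0 a b)
    with hC
  have hne : ∀ {a b}, C a b → ¬ IsPNE z (replyProfile 0 a b) := fun h => hs _ h
  have hcol : ∀ {a b a'}, C a b →
      payoffBlock z (0, b) a ≤ payoffBlock z (0, b) a' → C a' b := by
    intro a b a' h hle
    by_cases ha : a' = a
    · rwa [ha]
    · exact h.tail ⟨0, replyProfile_mem_betterResponses.2 ⟨ha, hle⟩⟩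
  have hrow : ∀ {a b b'}, C a b →
      payoffBlock z (1, a) b ≤ payoffBlock z (1, a) b' → C a b' := by
    intro a b b' h hle
    by_cases hb : b' = b
    · rwa [hb]
    · refine h.tail ⟨1, ?_⟩
      have h1 : ∀ y, replyProfile 0 a y = replyProfile 1 y a := fun y =>
        (replyProfile_swap 0 a y).symm
      rw [h1, h1]
      exact replyProfile_mem_betterResponses.2 ⟨hb, hle⟩
  obtain ⟨h₀col, h₀row⟩ := isPNE_replyProfile_iff.1 h₀
  have hC₀ : ¬ C a₀ b₀ := fun h => hne h h₀
  have hca : ∀ {a b}, C a b → a ≠ a₀ := by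
    rintro a b h rfl
    exact hC₀ (hrow h (h₀row b))
  have hcb : ∀ {a b}, C a b → b ≠ b₀ := by
    rintro a b h rfl
    exact hC₀ (hcol h (h₀col a))
  have hra : ∀ {a b}, C a b → payoffBlock z (1, a) b₀ < payoffBlock z (1, a) b := by
    intro a b h
    by_contra! hle
    exact hcb (hrow h hle) rfl
  have hrb : ∀ {a b}, C a b → payoffBlock z (0, b) a₀ < payoffBlock z (0, b) a := by
    intro a b h
    by_contra! hle
    exact hca (hcol h hle) rfl
  have hs0 : C (s 0) (s 1) := by
    have : replyProfile 0 (s 0) (s 1) = s := replyProfile_eta 0 s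
    rw [hC]
    simp only [this]
    exact .refl
  have hab : C (s 0) (bestReply z (1, s 0)) := hrow hs0 (le_bestReply z _ _)
  set a := s 0
  set b := bestReply z (1, a) with hb
  have hαb : C (bestReply z (0, b)) b := hcol hab (le_bestReply z _ _)
  have hlt : payoffBlock z (0, b) a < payoffBlock z (0, b) (bestReply z (0, b)) := by
    refine (le_bestReply z (0, b) a).lt_of_ne fun heq => hne hab ?_
    rw [isPNE_replyProfile_iff]
    exact ⟨fun y => heq ▸ le_bestReply z (0, b) y, fun y => le_bestReply z (1, a) y⟩
  exact ⟨a, b, bestReply z (0, b),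
    { best_row := h₀row
      best_col := h₀col
      best_row' := le_bestReply z (1, a)
      best_col' := le_bestReply z (0, b)
      lt := hlt
      ne_row := hca hab
      ne_col := hcb hab
      avoid_col := fun y hy => ⟨hca (hcol hab hy.le), hra (hcol hab hy.le)⟩
      avoid_row := fun y hy => ⟨hcb (hrow hαb hy.le), hrb (hrow hαb hy.le)⟩ }⟩

/-- Without traps, better responses converge as soon as there is an equilibrium. -/
theorem iSup_absorbedProb_betterResponses {z : Payoffs K} (hz : NoTies z)
    (hE : ∃ s, IsPNE z s) (htrap : ∀ a₀ b₀ a b α, ¬ IsTrap z a₀ b₀ a b α) (s : Profile K) :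
    ⨆ n, absorbedProb (betterResponses z) s n = 1 := by
  refine iSup_absorbedProb_eq_one (fun s => ?_) s
  by_contra! hcon
  obtain ⟨s₀, hs₀⟩ := hE
  have h₀ : IsPNE z (replyProfile 0 (s₀ 0) (s₀ 1)) := by
    have : replyProfile 0 (s₀ 0) (s₀ 1) = s₀ := replyProfile_eta 0 s₀
    rwa [this]
  obtain ⟨a, b, α, h⟩ := exists_isTrap h₀ (s := s) fun t ht hpne => by
    obtain ⟨i, hi⟩ := hcon t ht
    exact hi.ne_empty (hpne.betterResponses_eq_empty hz i)
  exact htrap _ _ _ _ _ h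

end Better

/-! ### Best responses: iteration of a bipartite mapping -/

section Best

variable {K : ℕ}

/-- Given the replies `F p` of the players `p.1` to the strategies `p.2` of their opponents, the
successor of `p` asks for the reply to the reply. -/
def nextReply (F : Fin 2 × Fin K → Fin K) (p : Fin 2 × Fin K) : Fin 2 × Fin K := (1 - p.1, F p)

lemma nextReply_nextReply_eq_self_iff {F : Fin 2 × Fin K → Fin K} {p : Fin 2 × Fin K} :
    nextReply F (nextReply F p) = p ↔ F (1 - p.1, F p) = p.2 := by
  simp [nextReply, Prod.ext_iff]

/-- The iteration of replies from `p` ends up in two strategies that are replies to each other. -/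
def EndsInPair (F : Fin 2 × Fin K → Fin K) (p : Fin 2 × Fin K) : Prop :=
  ∃ n, (nextReply F)^[n + 2] p = (nextReply F)^[n] p

lemma EndsInPair.of_nextReply {F : Fin 2 × Fin K → Fin K} {p : Fin 2 × Fin K}
    (h : EndsInPair F (nextReply F p)) : EndsInPair F p := by
  obtain ⟨n, hn⟩ := h
  exact ⟨n + 1, by simpa only [← Function.iterate_succ_apply] using hn⟩

variable [NeZero K]

lemma absorbing_bestResponses_iff {z : Payoffs K} (hz : NoTies z) (p : Fin 2 × Fin K) :
    (∀ i, bestResponses z i (replyProfile p.1 (bestReply z p) p.2) = ∅) ↔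
      nextReply (bestReply z) (nextReply (bestReply z) p) = p := by
  obtain ⟨i, x⟩ := p
  rw [nextReply_nextReply_eq_self_iff]
  simp only [hz.bestResponses_eq]
  constructor
  · intro h
    have := h (1 - i)
    by_contra hne
    simp [hne] at this
  · intro h j
    rcases eq_or_eq_one_sub i j with rfl | rfl
    · simp
    · simp [h]

/-- At a profile where one player plays a best reply, the step of the best-response dynamics is
deterministic. -/
lemma stepLaw_bestResponses {z : Payoffs K} (hz : NoTies z) (p : Fin 2 × Fin K) :
    stepLaw (fun i => bestResponses z i (replyProfile p.1 (bestReply z p) p.2))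
      (replyProfile p.1 (bestReply z p) p.2) =
      PMF.pure (replyProfile (nextReply (bestReply z) p).1
        (bestReply z (nextReply (bestReply z) p)) (nextReply (bestReply z) p).2) := by
  by_cases h : nextReply (bestReply z) (nextReply (bestReply z) p) = p
  · rw [stepLaw_of_isEmpty ((absorbing_bestResponses_iff hz p).2 h)]
    rw [nextReply_nextReply_eq_self_iff] at h
    simp only [nextReply, h, replyProfile_swap]
  · obtain ⟨i, x⟩ := p
    rw [nextReply_nextReply_eq_self_iff] at h
    set t := replyProfile (1 - i) (bestReply z (1 - i, bestReply z (i, x))) (bestReply z (i, x))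
    have h0 : bestResponses z i (replyProfile i (bestReply z (i, x)) x) = ∅ := by
      simp [hz.bestResponses_eq]
    have h1 : bestResponses z (1 - i) (replyProfile i (bestReply z (i, x)) x) = {t} := by
      rw [hz.bestResponses_eq]
      simp [h, t]
    have hp : ∀ (S : Finset (Profile K)) (hS : S.Nonempty), S = {t} →
        PMF.uniformOfFinset S hS = PMF.pure t := by
      rintro S hS rfl
      ext u
      simp [PMF.uniformOfFinset_apply, PMF.pure_apply]
    have hbind : ∀ q : PMF (Fin 2), q.bind (fun _ => PMF.pure t) = PMF.pure t := fun q =>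
      PMF.bind_const _ _
    simp only [nextReply, stepLaw]
    rw [← hbind (PMF.uniformOfFintype (Fin 2))]
    congr 1
    funext j
    rcases eq_or_eq_one_sub i j with rfl | rfl
    · rw [dif_neg (by simp [h0]), dif_pos (by simp [h1])]
      exact hp _ _ h1
    · rw [dif_pos (by simp [h1])]
      exact hp _ _ h1

open Classical in
lemma absorbedProb_bestResponses_le {z : Payoffs K} (hz : NoTies z) (p : Fin 2 × Fin K) (n : ℕ) :
    absorbedProb (bestResponses z) (replyProfile p.1 (bestReply z p) p.2) n ≤
      if EndsInPair (bestReply z) p then 1 else 0 := by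
  induction n generalizing p with
  | zero =>
    rw [absorbedProb_zero]
    by_cases h : nextReply (bestReply z) (nextReply (bestReply z) p) = p
    · rw [if_pos ((absorbing_bestResponses_iff hz p).2 h), if_pos ⟨0, h⟩]
    · rw [if_neg (mt (absorbing_bestResponses_iff hz p).1 h)]
      exact zero_le
  | succ n ih =>
    rw [absorbedProb_succ, stepLaw_bestResponses hz, Finset.sum_eq_single
      (replyProfile (nextReply (bestReply z) p).1 (bestReply z (nextReply (bestReply z) p))
        (nextReply (bestReply z) p).2)]
    · rw [PMF.pure_apply, if_pos rfl, one_mul]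
      refine (ih _).trans ?_
      split_ifs with h1 h2
      · exact le_rfl
      · exact absurd h1.of_nextReply h2
      · exact zero_le
      · exact le_rfl
    · intro t _ ht
      rw [PMF.pure_apply, if_neg ht, zero_mul]
    · simp

open Classical in
/-- The best-response dynamics converges only if the iteration of best replies ends up in a pair,
where the player drawn first determines the start of the iteration. -/
theorem absorbedProb_bestResponses_start_le {z : Payoffs K} (hz : NoTies z) (n : ℕ) :
    absorbedProb (bestResponses z) (fun _ => 0) n ≤
      ∑ i : Fin 2, 2⁻¹ * if EndsInPair (bestReply z) (i, 0) then 1 else 0 := by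
  refine (absorbedProb_le_succ _ n).trans ?_
  set s₀ : Profile K := fun _ => 0 with hs₀
  have hstep : ∀ (i : Fin 2) (q : PMF (Profile K)),
      (q = if h : (bestResponses z i s₀).Nonempty then PMF.uniformOfFinset _ h
        else if h' : (bestResponses z (1 - i) s₀).Nonempty then PMF.uniformOfFinset _ h'
        else PMF.pure s₀) →
      ∑ t, q t * absorbedProb (bestResponses z) t n ≤
        if EndsInPair (bestReply z) (i, 0) then 1 else 0 := by
    -- the move of player `i`, if there is one
    have hmove : ∀ (i : Fin 2) (h : (bestResponses z i s₀).Nonempty),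
        ∑ t, PMF.uniformOfFinset _ h t * absorbedProb (bestResponses z) t n ≤
          if EndsInPair (bestReply z) (i, 0) then 1 else 0 := by
      intro i h
      have hset : bestResponses z i s₀ = {replyProfile i (bestReply z (i, 0)) 0} := by
        rw [hz.bestResponses_eq] at h ⊢
        split_ifs with h1
        · simp [h1] at h
        · rfl
      rw [Finset.sum_eq_single (replyProfile i (bestReply z (i, 0)) 0)]
      · refine le_trans ?_ (absorbedProb_bestResponses_le hz (i, 0) n)
        exact (mul_le_mul_left (PMF.coe_le_one _ _) _).trans_eq (one_mul _)
      · intro t _ ht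
        rw [PMF.uniformOfFinset_apply_of_notMem, zero_mul]
        rw [hset]
        simpa using ht
      · simp
    -- without a move, player `i` already plays the best reply
    have hstay : ∀ i, ¬ (bestResponses z i s₀).Nonempty → bestReply z (i, 0) = 0 := by
      intro i h
      rw [hz.bestResponses_eq] at h
      by_contra hne
      have : bestReply z (i, s₀ (1 - i)) ≠ s₀ i := hne
      simp [this] at h
    rintro i q rfl
    by_cases h1 : (bestResponses z i s₀).Nonempty
    · simpa only [dif_pos h1] using hmove i h1
    · have hb := hstay i h1
      by_cases h2 : (bestResponses z (1 - i) s₀).Nonempty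
      · simp only [dif_neg h1, dif_pos h2]
        refine (hmove _ h2).trans ?_
        split_ifs with h3 h4
        · exact le_rfl
        · refine absurd (EndsInPair.of_nextReply ?_) h4
          rwa [nextReply, hb]
        · exact zero_le
        · exact le_rfl
      · simp only [dif_neg h1, dif_neg h2]
        rw [Finset.sum_eq_single s₀]
        · rw [PMF.pure_apply, if_pos rfl, one_mul]
          have : s₀ = replyProfile i (bestReply z (i, 0)) 0 := by
            rw [hb]
            ext j
            simp [s₀, replyProfile]
          rw [this]
          exact absorbedProb_bestResponses_le hz (i, 0) n
        · intro t _ ht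
          rw [PMF.pure_apply, if_neg ht, zero_mul]
        · simp
  rw [absorbedProb_succ]
  simp only [stepLaw, PMF.bind_apply, tsum_fintype, Finset.sum_mul, mul_assoc]
  rw [Finset.sum_comm]
  refine Finset.sum_le_sum fun i _ => ?_
  rw [← Finset.mul_sum, PMF.uniformOfFintype_apply, Fintype.card_fin, Nat.cast_ofNat]
  gcongr
  exact hstep i _ rfl

end Best

/-! ### Exchangeable blocks without ties -/

section Block

variable {K : ℕ} (ν : Measure ℝ) [IsProbabilityMeasure ν]

lemma measurePreserving_comp_perm (π : Equiv.Perm (Fin K)) :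
    MeasurePreserving (fun v : Fin K → ℝ => v ∘ π) (Measure.pi fun _ => ν)
      (Measure.pi fun _ => ν) := by
  have h := measurePreserving_piCongrLeft (fun _ : Fin K => ν) π.symm
  convert h using 1
  ext v y
  simp [MeasurableEquiv.piCongrLeft, Equiv.piCongrLeft, Equiv.piCongrLeft']

lemma measurable_lt_apply (x y : Fin K) : Measurable fun v : Fin K → ℝ => v x < v y :=
  measurableSet_setOfPred.1 (measurableSet_lt (measurable_pi_apply x) (measurable_pi_apply y))

lemma measurable_le_apply (x y : Fin K) : Measurable fun v : Fin K → ℝ => v x ≤ v y :=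
  measurableSet_setOfPred.1 (measurableSet_le (measurable_pi_apply x) (measurable_pi_apply y))

/-- The coordinates at which `v` is larger than at `x`. -/
noncomputable def above (v : Fin K → ℝ) (x : Fin K) : Finset (Fin K) :=
  Finset.univ.filter fun y => v x < v y

@[simp] lemma mem_above {v : Fin K → ℝ} {x y : Fin K} : y ∈ above v x ↔ v x < v y := by
  simp [above]

lemma above_eq_iff {v : Fin K → ℝ} {x : Fin K} {G : Finset (Fin K)} :
    above v x = G ↔ ∀ y, v x < v y ↔ y ∈ G := by
  simp [Finset.ext_iff]

lemma measurable_above_eq (x : Fin K) (G : Finset (Fin K)) :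
    Measurable fun v : Fin K → ℝ => above v x = G := by
  simp only [above_eq_iff]
  exact Measurable.forall fun y => (measurable_lt_apply x y).iff measurable_const

lemma measurable_card_above_eq (x : Fin K) (k : ℕ) :
    Measurable fun v : Fin K → ℝ => (above v x).card = k := by
  have : (fun v : Fin K → ℝ => (above v x).card = k) =
      fun v => ∃ G : Finset (Fin K), above v x = G ∧ G.card = k := by
    ext v; simp
  rw [this]
  exact Measurable.exists fun G => (measurable_above_eq x G).and measurable_const

lemma measurable_injective : Measurable fun v : Fin K → ℝ => Function.Injective v := by
  have : (fun v : Fin K → ℝ => Function.Injective v) =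
      fun v => ∀ x y, (v x ≤ v y ∧ v y ≤ v x) → x = y := by
    ext v
    simp only [Function.Injective, le_antisymm_iff]
  rw [this]
  exact Measurable.forall fun x => Measurable.forall fun y =>
    ((measurable_le_apply x y).and (measurable_le_apply y x)).imp measurable_const

lemma measurable_isTop (x : Fin K) : Measurable fun v : Fin K → ℝ => ∀ y, v y ≤ v x :=
  Measurable.forall fun y => measurable_le_apply y x

lemma above_comp_perm (v : Fin K → ℝ) (π : Equiv.Perm (Fin K)) (x : Fin K) :
    (above (v ∘ π) x).card = (above v (π x)).card := by
  refine Finset.card_bij (fun y _ => π y) ?_ ?_ ?_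
  · simp
  · simp
  · intro y hy
    exact ⟨π.symm y, by simpa using hy, by simp⟩

lemma card_above_lt {v : Fin K → ℝ} {x y : Fin K} (h : v x < v y) :
    (above v y).card < (above v x).card := by
  refine Finset.card_lt_card ⟨fun u hu => ?_, fun hsub => ?_⟩
  · simp only [mem_above] at *
    exact h.trans hu
  · have : y ∈ above v y := hsub (by simpa using h)
    simp at this

lemma eq_of_card_above_eq {v : Fin K → ℝ} (hv : Function.Injective v) {x y : Fin K}
    (h : (above v x).card = (above v y).card) : x = y := by
  by_contra hne
  rcases lt_or_gt_of_ne (hv.ne hne) with hlt | hlt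
  · exact (card_above_lt hlt).ne' h
  · exact (card_above_lt hlt).ne h

/-- Disjoint events of equal probability, one for each element of a finite type, have probability
at most the inverse of the number of elements. -/
lemma measureReal_le_inv_card {Ω ι : Type*} [MeasurableSpace Ω] [Fintype ι] (ρ : Measure Ω)
    [IsProbabilityMeasure ρ] (E : ι → Set Ω) (hE : ∀ j, MeasurableSet (E j))
    (hd : Pairwise fun i j => Disjoint (E i) (E j)) (heq : ∀ i j, ρ.real (E i) = ρ.real (E j))
    (j : ι) : ρ.real (E j) ≤ 1 / Fintype.card ι := by
  have h1 : ∑ i, ρ.real (E i) ≤ 1 := by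
    rw [← measureReal_iUnion_fintype hd hE]
    exact measureReal_le_one
  have hpos : (0 : ℝ) < Fintype.card ι := by
    have : Nonempty ι := ⟨j⟩
    exact_mod_cast Fintype.card_pos
  rw [Finset.sum_congr rfl fun i _ => heq i j, Finset.sum_const, Finset.card_univ,
    nsmul_eq_mul] at h1
  rwa [le_div_iff₀ hpos, mul_comm]

lemma measureReal_lt_le (x y : Fin K) :
    (Measure.pi fun _ : Fin K => ν).real {v | v x < v y} ≤ 1 / 2 := by
  have hm : ∀ x y : Fin K, MeasurableSet {v : Fin K → ℝ | v x < v y} := fun x y =>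
    measurableSet_setOfPred.2 (measurable_lt_apply x y)
  have hswap : (Measure.pi fun _ : Fin K => ν).real {v | v y < v x} =
      (Measure.pi fun _ : Fin K => ν).real {v | v x < v y} := by
    rw [measureReal_def, measureReal_def,
      ← (measurePreserving_comp_perm ν (Equiv.swap x y)).measure_preimage
        (hm y x).nullMeasurableSet]
    congr 2
    ext v
    simp
  have hdisj : Disjoint {v : Fin K → ℝ | v x < v y} {v | v y < v x} := by
    rw [Set.disjoint_left]
    intro v h1 h2
    exact lt_asymm (α := ℝ) h1 h2
  have h := measureReal_union (μ := Measure.pi fun _ : Fin K => ν) hdisj (hm y x)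
  have h1 : (Measure.pi fun _ : Fin K => ν).real ({v | v x < v y} ∪ {v | v y < v x}) ≤ 1 :=
    measureReal_le_one
  linarith

variable {ν} (hν : ∀ x, ν {x} = 0)

include hν

lemma ae_injective_pi : ∀ᵐ v ∂(Measure.pi fun _ : Fin K => ν), Function.Injective v := by
  have h : ∀ x y : Fin K, x ≠ y → ∀ᵐ v ∂(Measure.pi fun _ : Fin K => ν), v x ≠ v y := by
    intro x y hxy
    have hind : IndepFun (fun v : Fin K → ℝ => v x) (fun v => v y)
        (Measure.pi fun _ : Fin K => ν) :=
      (iIndepFun_pi (X := fun _ : Fin K => (id : ℝ → ℝ)) (μ := fun _ : Fin K => ν)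
        fun _ => aemeasurable_id).indepFun hxy
    rw [indepFun_iff_map_prod_eq_prod_map_map (measurable_pi_apply x).aemeasurable
      (measurable_pi_apply y).aemeasurable] at hind
    have hev : ∀ x : Fin K, (Measure.pi fun _ : Fin K => ν).map (fun v => v x) = ν := fun x =>
      (measurePreserving_eval (fun _ : Fin K => ν) x).map_eq
    rw [hev, hev] at hind
    have hm : Measurable fun v : Fin K → ℝ => (v x, v y) := by fun_prop
    have hdiag : MeasurableSet {q : ℝ × ℝ | q.1 = q.2} :=
      measurableSet_eq_fun measurable_fst measurable_snd
    rw [ae_iff]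
    have h0 : (ν.prod ν) {q : ℝ × ℝ | q.1 = q.2} = 0 := by
      rw [Measure.measure_prod_null hdiag]
      refine Eventually.of_forall fun u => ?_
      have : Prod.mk u ⁻¹' {q : ℝ × ℝ | q.1 = q.2} = {u} := by
        ext w; simp [eq_comm]
      simp [this, hν]
    rw [← hind, Measure.map_apply hm hdiag] at h0
    simpa using h0
  have h2 : ∀ᵐ v ∂(Measure.pi fun _ : Fin K => ν), ∀ x y : Fin K, x ≠ y → v x ≠ v y := by
    simp only [ae_all_iff]
    exact h
  filter_upwards [h2] with v hv x y hxy
  by_contra hne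
  exact hv x y hne hxy

lemma measureReal_pi_inter_injective (p : (Fin K → ℝ) → Prop) :
    (Measure.pi fun _ : Fin K => ν).real {v | p v} =
      (Measure.pi fun _ : Fin K => ν).real {v | Function.Injective v ∧ p v} := by
  refine measureReal_congr ?_
  filter_upwards [ae_injective_pi hν] with v hv
  exact propext ⟨fun h => ⟨hv, h⟩, fun h => h.2⟩

/-- The rank of each coordinate is uniformly distributed. -/
lemma measureReal_card_above_le (x : Fin K) (k : ℕ) :
    (Measure.pi fun _ : Fin K => ν).real {v | (above v x).card = k} ≤ 1 / K := by
  rw [measureReal_pi_inter_injective hν]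
  have hm : ∀ x, MeasurableSet {v : Fin K → ℝ | Function.Injective v ∧ (above v x).card = k} :=
    fun x => measurableSet_setOfPred.2 (measurable_injective.and (measurable_card_above_eq x k))
  have := measureReal_le_inv_card (Measure.pi fun _ : Fin K => ν)
    (fun x => {v | Function.Injective v ∧ (above v x).card = k}) hm ?_ ?_ x
  · simpa using this
  · intro i j hij
    rw [Set.disjoint_left]
    rintro v ⟨hv, h1⟩ ⟨_, h2⟩
    exact hij (eq_of_card_above_eq hv (h1.trans h2.symm))
  · intro i j
    rw [measureReal_def, measureReal_def,
      ← (measurePreserving_comp_perm ν (Equiv.swap i j)).measure_preimage (hm i).nullMeasurableSet]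
    congr 2
    ext v
    simp only [Set.preimage_ofPred_eq, Set.mem_ofPred_eq, above_comp_perm, Equiv.swap_apply_left]
    rw [Equiv.injective_comp]

lemma measureReal_isTop (x : Fin K) :
    (Measure.pi fun _ : Fin K => ν).real {v | ∀ y, v y ≤ v x} = 1 / K := by
  have htop : ∀ x, {v : Fin K → ℝ | ∀ y, v y ≤ v x} = {v | (above v x).card = 0} := by
    intro x
    ext v
    simp [Finset.eq_empty_iff_forall_notMem]
  have hle : ∀ x : Fin K, (Measure.pi fun _ : Fin K => ν).real {v | ∀ y, v y ≤ v x} ≤ 1 / K := by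
    intro x
    rw [htop]
    exact measureReal_card_above_le hν x 0
  refine le_antisymm (hle x) ?_
  by_contra! hlt
  have hK : (K : ℝ) ≠ 0 := by
    have : 0 < K := x.pos
    positivity
  have hone : (1 : ℝ) ≤ ∑ x : Fin K, (Measure.pi fun _ : Fin K => ν).real
      {v | ∀ y, v y ≤ v x} := by
    refine le_trans ?_ (measureReal_iUnion_fintype_le _)
    have : (⋃ x : Fin K, {v : Fin K → ℝ | ∀ y, v y ≤ v x}) = Set.univ := by
      rw [Set.eq_univ_iff_forall]
      intro v
      have : Nonempty (Fin K) := ⟨x⟩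
      simpa using Finite.exists_max v
    rw [this, probReal_univ]
  have : ∑ x : Fin K, (Measure.pi fun _ : Fin K => ν).real {v | ∀ y, v y ≤ v x} <
      ∑ _x : Fin K, 1 / (K : ℝ) :=
    Finset.sum_lt_sum (fun x _ => hle x) ⟨x, Finset.mem_univ x, hlt⟩
  rw [Finset.sum_const, Finset.card_univ, Fintype.card_fin, nsmul_eq_mul,
    mul_one_div_cancel hK] at this
  exact absurd hone this.not_ge

/-- The mean of `(1 / 2) ^ n`, where `n` is the number of coordinates above a given one. -/
lemma sum_measureReal_above_mul_le (x : Fin K) :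
    ∑ G : Finset (Fin K), (Measure.pi fun _ : Fin K => ν).real {v | above v x = G} *
      (1 / 2) ^ G.card ≤ 2 / K := by
  have h1 : ∀ k, ∑ G : Finset (Fin K) with G.card = k,
      (Measure.pi fun _ : Fin K => ν).real {v | above v x = G} ≤ 1 / K := by
    intro k
    refine le_trans (le_of_eq ?_) (measureReal_card_above_le hν x k)
    rw [← measureReal_biUnion_finset]
    · congr 1
      ext v
      simp
    · intro G _ G' _ hne
      rw [Function.onFun, Set.disjoint_left]
      intro v h h'
      exact hne (Eq.trans (Eq.symm h) h')
    · exact fun G _ => measurableSet_setOfPred.2 (measurable_above_eq x G)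
  rw [← Finset.sum_fiberwise_of_maps_to (t := Finset.range (K + 1)) (g := Finset.card)]
  · calc _ ≤ ∑ k ∈ Finset.range (K + 1), 1 / (K : ℝ) * (1 / 2) ^ k := by
          refine Finset.sum_le_sum fun k _ => ?_
          rw [Finset.sum_congr rfl fun G hG => by rw [(Finset.mem_filter.1 hG).2],
            ← Finset.sum_mul]
          gcongr
          exact h1 k
      _ ≤ 2 / K := by
          rw [← Finset.mul_sum, div_eq_mul_one_div 2, mul_comm]
          gcongr
          exact sum_geometric_two_le _
  · intro G _
    rw [Finset.mem_range, Nat.lt_succ_iff]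
    exact (Finset.card_le_univ G).trans_eq (Fintype.card_fin K)

lemma sum_measureReal_above_isTop_le (x : Fin K) (G : Finset (Fin K)) :
    ∑ α, (Measure.pi fun _ : Fin K => ν).real {v | above v x = G ∧ ∀ y, v y ≤ v α} ≤
      (Measure.pi fun _ : Fin K => ν).real {v | above v x = G} := by
  simp only [measureReal_pi_inter_injective hν fun v => above v x = G ∧ ∀ y, v y ≤ v _]
  rw [← measureReal_iUnion_fintype]
  · refine measureReal_mono ?_
    refine Set.iUnion_subset fun α v hv => hv.2.1
  · intro α β hne
    rw [Function.onFun, Set.disjoint_left]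
    intro v h h'
    exact hne (h.1 (le_antisymm (h'.2.2 α) (h.2.2 β)))
  · exact fun α => measurableSet_setOfPred.2
      (measurable_injective.and ((measurable_above_eq x G).and (measurable_isTop α)))

end Block

/-! ### The blocks of a random game -/

section RandomGame

variable {Ω : Type*} [MeasurableSpace Ω] {K : ℕ} {μ : Measure Ω} {Z : Ω → Payoffs K}

lemma IsRandomGame.measurable_payoffs (h : IsRandomGame μ Z) : Measurable Z :=
  measurable_pi_lambda _ fun i => measurable_pi_lambda _ fun s => h.measurable i s

lemma IsRandomGame.measurable_payoffBlock (h : IsRandomGame μ Z) (p : Fin 2 × Fin K) :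
    Measurable fun ω => payoffBlock (Z ω) p :=
  measurable_pi_lambda _ fun _ => h.measurable _ _

lemma measurableSet_betterResponses_eq (A : Fin 2 → Profile K → Finset (Profile K)) :
    MeasurableSet {z : Payoffs K | betterResponses z = A} := by
  simp only [funext_iff, Finset.ext_iff, mem_betterResponses]
  refine measurableSet_setOfPred.2 (Measurable.forall fun i => Measurable.forall fun s =>
    Measurable.forall fun t => Measurable.iff (measurable_const.and ?_) measurable_const)
  exact measurableSet_setOfPred.1 (measurableSet_le (by fun_prop) (by fun_prop))

lemma measurableSet_bestResponses_eq (A : Fin 2 → Profile K → Finset (Profile K)) :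
    MeasurableSet {z : Payoffs K | bestResponses z = A} := by
  have hle : ∀ i (s t : Profile K), Measurable fun z : Payoffs K => z i s ≤ z i t := fun i s t =>
    measurableSet_setOfPred.1 (measurableSet_le (by fun_prop) (by fun_prop))
  simp only [funext_iff, Finset.ext_iff, bestResponses, Finset.mem_filter, mem_betterResponses]
  refine measurableSet_setOfPred.2 (Measurable.forall fun i => Measurable.forall fun s =>
    Measurable.forall fun t => Measurable.iff (Measurable.and (measurable_const.and (hle _ _ _))
      (Measurable.forall fun u => measurable_const.imp (hle _ _ _))) measurable_const)

lemma measurableSet_pneEvent (h : IsRandomGame μ Z) : MeasurableSet (pneEvent Z) := by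
  refine measurableSet_setOfPred.2 (Measurable.exists fun s => Measurable.forall fun i =>
    Measurable.forall fun t => measurable_const.imp ?_)
  exact measurableSet_setOfPred.1 (measurableSet_le (h.measurable _ _) (h.measurable _ _))

lemma measureReal_payoffBlock {ν : Measure ℝ} {p : Fin 2 × Fin K}
    (h : IsRandomGame μ Z) (hp : μ.map (fun ω => payoffBlock (Z ω) p) = Measure.pi fun _ => ν)
    {q : (Fin K → ℝ) → Prop} (hq : Measurable q) :
    μ.real {ω | q (payoffBlock (Z ω) p)} = (Measure.pi fun _ => ν).real {v | q v} := by
  rw [← hp, measureReal_def, measureReal_def,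
    Measure.map_apply (h.measurable_payoffBlock p) (measurableSet_setOfPred.2 hq)]
  rfl

variable [IsProbabilityMeasure μ]

/-- The blocks are independent, and each of them is an i.i.d. vector with atomless entries. -/
lemma IsRandomGame.blocks (h : IsRandomGame μ Z) [NeZero K] :
    iIndepFun (fun p ω => payoffBlock (Z ω) p) μ ∧
      ∃ ν : Measure ℝ, IsProbabilityMeasure ν ∧ (∀ x, ν {x} = 0) ∧
        ∀ p, μ.map (fun ω => payoffBlock (Z ω) p) = Measure.pi fun _ => ν := by
  let s₀ : Profile K := fun _ => 0
  let ν : Measure ℝ := μ.map fun ω => Z ω 0 s₀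
  have hν : IsProbabilityMeasure ν :=
    Measure.isProbabilityMeasure_map (h.measurable 0 s₀).aemeasurable
  let W : (Fin 2 × Fin K) × Fin K → Ω → ℝ := fun q ω => payoffBlock (Z ω) q.1 q.2
  have hWm : ∀ q, Measurable (W q) := fun q => h.measurable _ _
  have hinj : Function.Injective fun q : (Fin 2 × Fin K) × Fin K =>
      (q.1.1, replyProfile q.1.1 q.2 q.1.2) := by
    rintro ⟨⟨i, x⟩, y⟩ ⟨⟨i', x'⟩, y'⟩ hq
    simp only [Prod.mk.injEq] at hq
    obtain ⟨rfl, hq⟩ := hq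
    have h1 := congrFun hq i
    have h2 := congrFun hq (1 - i)
    simp only [replyProfile_self, replyProfile_other] at h1 h2
    rw [h1, h2]
  have hW : iIndepFun W μ := h.indep.precomp hinj
  have hWmap : ∀ q, μ.map (W q) = ν := fun q => (h.identDistrib _ _ _ _).map_eq
  have hlaw : μ.map (fun ω p => payoffBlock (Z ω) p) =
      Measure.infinitePi fun _ => Measure.infinitePi fun _ => ν := by
    have h1 := hW.map_fun_eq_infinitePi_map hWm
    simp only [hWmap] at h1
    have h2 := Measure.infinitePi_map_curry (ι := Fin 2 × Fin K) (κ := Fin K) fun _ _ => ν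
    rw [← h1, Measure.map_map (by fun_prop) (by fun_prop)] at h2
    exact h2
  have hmap : ∀ p, μ.map (fun ω => payoffBlock (Z ω) p) = Measure.infinitePi fun _ => ν := by
    intro p
    rw [← Measure.infinitePi_map_eval (fun _ : Fin 2 × Fin K =>
      Measure.infinitePi fun _ : Fin K => ν) p, ← hlaw, Measure.map_map (by fun_prop)
      (measurable_pi_lambda _ h.measurable_payoffBlock)]
    rfl
  refine ⟨?_, ν, hν, fun x => ?_, fun p => ?_⟩
  · rw [iIndepFun_iff_map_fun_eq_infinitePi_map h.measurable_payoffBlock, hlaw]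
    simp only [hmap]
  · rw [Measure.map_apply (h.measurable 0 s₀) (measurableSet_singleton x)]
    exact h.noAtoms 0 s₀ x
  · rw [hmap, Measure.infinitePi_eq_pi]

/-- Independence of the blocks, for an event that is an intersection over the blocks. -/
lemma IsRandomGame.measureReal_forall [NeZero K] (h : IsRandomGame μ Z)
    {q : Fin 2 × Fin K → (Fin K → ℝ) → Prop} (hq : ∀ p, Measurable (q p)) :
    μ.real {ω | ∀ p, q p (payoffBlock (Z ω) p)} =
      ∏ p, μ.real {ω | q p (payoffBlock (Z ω) p)} := by
  have := h.blocks.1.measure_inter_preimage_eq_mul Finset.univ (sets := fun p => {v | q p v})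
    fun p _ => measurableSet_setOfPred.2 (hq p)
  simp only [measureReal_def, ← ENNReal.toReal_prod]
  congr 1
  refine Eq.trans (congrArg μ ?_) this
  ext ω
  simp

lemma IsRandomGame.ae_noTies [NeZero K] (h : IsRandomGame μ Z) : ∀ᵐ ω ∂μ, NoTies (Z ω) := by
  obtain ⟨-, ν, hν, hν0, hmap⟩ := h.blocks
  refine ae_all_iff.2 fun p => ?_
  have h1 := ae_injective_pi (K := K) hν0
  rw [← hmap p] at h1
  exact ae_of_ae_map (h.measurable_payoffBlock p).aemeasurable h1

/-- The best replies are independent and uniformly distributed. -/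
lemma IsRandomGame.measureReal_bestReply_eq [NeZero K] (h : IsRandomGame μ Z)
    (f : Fin 2 × Fin K → Fin K) :
    μ.real {ω | bestReply (Z ω) = f} = (1 / (K : ℝ)) ^ (2 * K) := by
  obtain ⟨-, ν, hν, hν0, hmap⟩ := h.blocks
  have h1 : μ.real {ω | bestReply (Z ω) = f} =
      μ.real {ω | ∀ p, ∀ y, payoffBlock (Z ω) p y ≤ payoffBlock (Z ω) p (f p)} := by
    refine measureReal_congr ?_
    filter_upwards [h.ae_noTies] with ω hω
    refine propext ?_
    change bestReply (Z ω) = f ↔ _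
    simp only [funext_iff, hω.eq_bestReply_iff]
    rfl
  rw [h1, h.measureReal_forall (q := fun p v => ∀ y, v y ≤ v (f p))
    fun p => measurable_isTop (f p), Finset.prod_congr rfl fun p _ => by
      rw [measureReal_payoffBlock h (hmap p) (q := fun v => ∀ y, v y ≤ v (f p))
        (measurable_isTop (f p)), measureReal_isTop hν0]]
  simp

/-- Probabilities of events that depend on the best replies only can be found by counting. -/
lemma IsRandomGame.measureReal_bestReply [NeZero K] (h : IsRandomGame μ Z)
    (D : Finset (Fin 2 × Fin K → Fin K)) :
    μ.real {ω | bestReply (Z ω) ∈ D} = D.card * (1 / (K : ℝ)) ^ (2 * K) := by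
  have hm : ∀ f, NullMeasurableSet {ω | bestReply (Z ω) = f} μ := by
    intro f
    have h1 : MeasurableSet {ω | ∀ p, ∀ y, payoffBlock (Z ω) p y ≤ payoffBlock (Z ω) p (f p)} := by
      refine measurableSet_setOfPred.2 (Measurable.forall fun p => ?_)
      exact (measurable_isTop (f p)).comp (h.measurable_payoffBlock p)
    refine h1.nullMeasurableSet.congr ?_
    filter_upwards [h.ae_noTies] with ω hω
    refine propext ?_
    change _ ↔ bestReply (Z ω) = f
    simp only [funext_iff, hω.eq_bestReply_iff]
    rfl
  have h1 : {ω | bestReply (Z ω) ∈ D} = ⋃ f ∈ D, {ω | bestReply (Z ω) = f} := by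
    ext ω
    simp
  rw [h1, measureReal_biUnion_finset₀]
  · simp only [h.measureReal_bestReply_eq, Finset.sum_const, nsmul_eq_mul]
  · intro f _ g _ hfg
    refine Disjoint.aedisjoint ?_
    rw [Set.disjoint_left]
    intro ω h1 h2
    exact hfg (Eq.trans (Eq.symm h1) h2)
  · exact fun f _ => hm f

end RandomGame

/-! ### The path of a uniformly random bipartite mapping -/

/-- Deferred decisions: if neither the family `D`, nor the position `pos F`, nor the set `A F`
depends on the value of `F ∈ D` at the position `pos F`, then this value is uniformly distributed
on `D`. -/
lemma card_mul_card_filter_apply_mem {ι β : Type*} [Fintype ι] [DecidableEq ι] [Fintype β]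
    [DecidableEq β] (D : Finset (ι → β)) (pos : (ι → β) → ι) (A : (ι → β) → Finset β)
    (hD : ∀ F ∈ D, ∀ w, Function.update F (pos F) w ∈ D)
    (hpos : ∀ F ∈ D, ∀ w, pos (Function.update F (pos F) w) = pos F)
    (hA : ∀ F ∈ D, ∀ w, A (Function.update F (pos F) w) = A F) :
    Fintype.card β * (D.filter fun F => F (pos F) ∈ A F).card = ∑ F ∈ D, (A F).card := by
  rw [mul_comm, ← Finset.card_univ, ← Finset.card_product, ← Finset.card_sigma]
  refine Finset.card_bij'
    (i := fun q _ => (⟨Function.update q.1 (pos q.1) q.2, q.1 (pos q.1)⟩ : Σ _ : ι → β, β))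
    (j := fun q _ => (Function.update q.1 (pos q.1) q.2, q.1 (pos q.1))) ?_ ?_ ?_ ?_
  · rintro ⟨F, w⟩ hq
    simp only [Finset.mem_product, Finset.mem_filter, Finset.mem_univ, and_true] at hq
    simp only [Finset.mem_sigma]
    exact ⟨hD F hq.1 w, by rw [hA F hq.1]; exact hq.2⟩
  · rintro ⟨F, w⟩ hq
    simp only [Finset.mem_sigma] at hq
    simp only [Finset.mem_product, Finset.mem_filter, Finset.mem_univ, and_true]
    refine ⟨hD F hq.1 w, ?_⟩
    rw [hA F hq.1, hpos F hq.1, Function.update_self]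
    exact hq.2
  · rintro ⟨F, w⟩ hq
    simp only [Finset.mem_product, Finset.mem_filter, Finset.mem_univ, and_true] at hq
    simp [hpos F hq.1]
  · rintro ⟨F, w⟩ hq
    simp only [Finset.mem_sigma] at hq
    simp [hpos F hq.1]

section Path

variable {K : ℕ}

lemma nextReply_iterate_fst_succ (F : Fin 2 × Fin K → Fin K) (p : Fin 2 × Fin K) (n : ℕ) :
    ((nextReply F)^[n + 1] p).1 = 1 - ((nextReply F)^[n] p).1 := by
  rw [Function.iterate_succ_apply']
  rfl

lemma nextReply_iterate_snd_succ (F : Fin 2 × Fin K → Fin K) (p : Fin 2 × Fin K) (n : ℕ) :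
    ((nextReply F)^[n + 1] p).2 = F ((nextReply F)^[n] p) := by
  rw [Function.iterate_succ_apply']
  rfl

/-- The mappings for which the first `n` steps of the iteration from `p` lead to new places. -/
noncomputable def freshMaps (p : Fin 2 × Fin K) (n : ℕ) : Finset (Fin 2 × Fin K → Fin K) := by
  classical
  exact Finset.univ.filter fun F => Set.InjOn (fun j => (nextReply F)^[j] p) (Set.Iic n)

lemma mem_freshMaps {p : Fin 2 × Fin K} {n : ℕ} {F : Fin 2 × Fin K → Fin K} :
    F ∈ freshMaps p n ↔ Set.InjOn (fun j => (nextReply F)^[j] p) (Set.Iic n) := by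
  simp [freshMaps]

/-- Up to the first return after two steps, all places on the path are new: a longer cycle entered
before would exclude such a return. -/
lemma EndsInPair.exists_freshMaps {F : Fin 2 × Fin K → Fin K} {p : Fin 2 × Fin K}
    (h : EndsInPair F p) :
    ∃ n, F ∈ freshMaps p (n + 1) ∧ (nextReply F)^[n + 2] p = (nextReply F)^[n] p := by
  classical
  refine ⟨Nat.find h, ?_, Nat.find_spec h⟩
  set m := Nat.find h with hm
  have hper : ∀ t, (nextReply F)^[m + 2 + t] p = (nextReply F)^[m + t] p := by
    intro t
    rw [add_comm, Function.iterate_add_apply, Nat.find_spec h, ← Function.iterate_add_apply,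
      add_comm t]
  have key : ∀ i j, i < j → j ≤ m + 1 → (nextReply F)^[i] p ≠ (nextReply F)^[j] p := by
    intro i j hij hj heq
    have h1 : ∀ t, (nextReply F)^[i + t] p = (nextReply F)^[i + t + (j - i)] p := by
      intro t
      rw [show i + t + (j - i) = t + j by omega, add_comm i, Function.iterate_add_apply, heq,
        ← Function.iterate_add_apply]
    have h2 : ∀ k t, (nextReply F)^[i + t] p = (nextReply F)^[i + t + (j - i) * k] p := by
      intro k t
      induction k with
      | zero => simp
      | succ k ih =>
        rw [ih, show i + t + (j - i) * k = i + (t + (j - i) * k) by ring, h1]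
        congr 1
        ring
    -- a period of the path past `i` would make `i` a time of return after two steps
    have h3 : (nextReply F)^[i + 2] p = (nextReply F)^[i] p := by
      have hle : m ≤ i + (j - i) * m := by
        have : 1 * m ≤ (j - i) * m := Nat.mul_le_mul_right m (by omega)
        omega
      rw [h2 m 2, show i + 2 + (j - i) * m = m + 2 + (i + (j - i) * m - m) by omega, hper,
        show m + (i + (j - i) * m - m) = i + 0 + (j - i) * m by omega, ← h2 m 0, add_zero]
    have h4 : m ≤ i := Nat.find_min' h h3
    obtain rfl : j = i + 1 := by omega
    have h5 := nextReply_iterate_fst_succ F p i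
    rw [← heq] at h5
    exact one_sub_ne _ h5.symm
  rw [mem_freshMaps]
  intro i hi j hj hij
  by_contra hne
  rcases lt_or_gt_of_ne hne with hlt | hlt
  · exact key i j hlt hj hij
  · exact key j i hlt hi hij.symm

lemma iterate_update_of_mem_freshMaps {F : Fin 2 × Fin K → Fin K} {p : Fin 2 × Fin K} {n : ℕ}
    (hF : F ∈ freshMaps p n) (w : Fin K) {j : ℕ} (hj : j ≤ n) :
    (nextReply (Function.update F ((nextReply F)^[n] p) w))^[j] p = (nextReply F)^[j] p := by
  induction j with
  | zero => rfl
  | succ j ih =>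
    rw [Function.iterate_succ_apply', Function.iterate_succ_apply', ih (by omega), nextReply,
      nextReply, Function.update_of_ne]
    intro heq
    have := mem_freshMaps.1 hF (by simp; omega) (by simp) heq
    omega

lemma update_mem_freshMaps {F : Fin 2 × Fin K → Fin K} {p : Fin 2 × Fin K} {n : ℕ}
    (hF : F ∈ freshMaps p n) (w : Fin K) :
    Function.update F ((nextReply F)^[n] p) w ∈ freshMaps p n := by
  rw [mem_freshMaps]
  intro i hi j hj hij
  simp only at hij
  rw [iterate_update_of_mem_freshMaps hF w hi, iterate_update_of_mem_freshMaps hF w hj] at hij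
  exact mem_freshMaps.1 hF hi hj hij

/-- From a new place, the path returns to the place before with probability `1 / K`. -/
lemma mul_card_freshMaps_filter_return (p : Fin 2 × Fin K) (n : ℕ) :
    K * ((freshMaps p (n + 1)).filter fun F =>
      (nextReply F)^[n + 2] p = (nextReply F)^[n] p).card = (freshMaps p (n + 1)).card := by
  have h := card_mul_card_filter_apply_mem (freshMaps p (n + 1))
    (fun F => (nextReply F)^[n + 1] p) (fun F => {((nextReply F)^[n] p).2})
    (fun F hF w => update_mem_freshMaps hF w)
    (fun F hF w => iterate_update_of_mem_freshMaps hF w le_rfl)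
    (fun F hF w => by rw [iterate_update_of_mem_freshMaps hF w n.le_succ])
  rw [Fintype.card_fin] at h
  simp only [Finset.card_singleton, Finset.sum_const, smul_eq_mul, mul_one,
    Finset.mem_singleton] at h
  rw [← h]
  congr 3
  ext F
  rw [Prod.ext_iff, nextReply_iterate_fst_succ, nextReply_iterate_fst_succ,
    nextReply_iterate_snd_succ]
  simp

/-- On a path with `n` new steps, the next step is new with probability at most
`1 - ⌊(n + 1) / 2⌋ / K`, since it must avoid the places visited on the opposite side. -/
lemma mul_card_freshMaps_succ_le (p : Fin 2 × Fin K) (n : ℕ) :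
    K * (freshMaps p (n + 1)).card + (n + 1) / 2 * (freshMaps p n).card ≤
      K * (freshMaps p n).card := by
  classical
  let A : (Fin 2 × Fin K → Fin K) → Finset (Fin K) := fun F =>
    Finset.univ.filter fun v => ∀ j ≤ n, (nextReply F)^[j] p ≠ (1 - ((nextReply F)^[n] p).1, v)
  have h := card_mul_card_filter_apply_mem (freshMaps p n)
    (fun F => (nextReply F)^[n] p) A
    (fun F hF w => update_mem_freshMaps hF w)
    (fun F hF w => iterate_update_of_mem_freshMaps hF w le_rfl)
    (fun F hF w => by
      ext v
      simp only [A, Finset.mem_filter, Finset.mem_univ, true_and]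
      refine forall₂_congr fun j hj => ?_
      rw [iterate_update_of_mem_freshMaps hF w hj, iterate_update_of_mem_freshMaps hF w le_rfl])
  have hset : freshMaps p (n + 1) =
      (freshMaps p n).filter fun F => F ((nextReply F)^[n] p) ∈ A F := by
    ext F
    have hnext : (1 - ((nextReply F)^[n] p).1, F ((nextReply F)^[n] p)) =
        (nextReply F)^[n + 1] p := by
      rw [Function.iterate_succ_apply']; rfl
    simp only [Finset.mem_filter, mem_freshMaps, A, Finset.mem_univ, true_and, hnext]
    have hins : Set.Iic (n + 1) = insert (n + 1) (Set.Iic n) := by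
      ext j; simp; omega
    rw [hins, Set.injOn_insert (by simp)]
    simp
  -- the strategies of the other side visited at the times `n - 1, n - 3, …` are excluded
  have hcard : ∀ F ∈ freshMaps p n, (A F).card + (n + 1) / 2 ≤ K := by
    intro F hF
    have hpar : ∀ i, 2 * i + 1 ≤ n →
        ((nextReply F)^[n - (2 * i + 1)] p).1 = 1 - ((nextReply F)^[n] p).1 := by
      intro i
      induction i with
      | zero =>
        intro hi
        obtain ⟨m, rfl⟩ : ∃ m, n = m + 1 := ⟨n - 1, by omega⟩
        rw [nextReply_iterate_fst_succ]
        simp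
      | succ i ih =>
        intro hi
        obtain ⟨m, hm⟩ : ∃ m, n = m + (2 * (i + 1) + 1) := ⟨n - (2 * (i + 1) + 1), by omega⟩
        rw [← ih (by omega), show n - (2 * i + 1) = m + 1 + 1 by omega,
          show n - (2 * (i + 1) + 1) = m by omega, nextReply_iterate_fst_succ,
          nextReply_iterate_fst_succ]
        simp
    let B : Finset (Fin K) := (Finset.range ((n + 1) / 2)).image fun i =>
      ((nextReply F)^[n - (2 * i + 1)] p).2
    have hB : B.card = (n + 1) / 2 := by
      rw [Finset.card_image_of_injOn, Finset.card_range]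
      intro i hi j hj hij
      simp only [Finset.coe_range, Set.mem_Iio] at hi hj
      have := mem_freshMaps.1 hF (show n - (2 * i + 1) ∈ Set.Iic n by simp)
        (show n - (2 * j + 1) ∈ Set.Iic n by simp)
        (Prod.ext ((hpar i (by omega)).trans (hpar j (by omega)).symm) hij)
      omega
    have hdisj : Disjoint (A F) B := by
      rw [Finset.disjoint_left]
      intro v hv hvB
      obtain ⟨i, hi, rfl⟩ := Finset.mem_image.1 hvB
      rw [Finset.mem_range] at hi
      refine (Finset.mem_filter.1 hv).2 (n - (2 * i + 1)) (Nat.sub_le _ _) ?_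
      exact Prod.ext (hpar i (by omega)) rfl
    have := Finset.card_le_univ (A F ∪ B)
    rwa [Finset.card_union_of_disjoint hdisj, hB, Fintype.card_fin] at this
  rw [hset]
  rw [Fintype.card_fin] at h
  rw [h, mul_comm ((n + 1) / 2), ← smul_eq_mul, ← Finset.sum_const, ← Finset.sum_add_distrib]
  refine (Finset.sum_le_sum hcard).trans_eq ?_
  simp [mul_comm]

variable [NeZero K]

/-- The probability that the first `n` steps lead to new places is at most `exp (-⌊n²/4⌋/K)`. -/
lemma card_freshMaps_le (p : Fin 2 × Fin K) (n : ℕ) :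
    ((freshMaps p n).card : ℝ) * (1 / (K : ℝ)) ^ (2 * K) ≤
      Real.exp (-((n ^ 2 / 4 : ℕ) : ℝ) / K) := by
  have hK : (0 : ℝ) < K := by exact_mod_cast Nat.pos_of_ne_zero (NeZero.ne K)
  induction n with
  | zero =>
    have h1 : ((freshMaps p 0).card : ℝ) ≤ (K : ℝ) ^ (2 * K) := by
      have := Finset.card_le_univ (freshMaps p 0)
      simp only [Fintype.card_fun, Fintype.card_prod, Fintype.card_fin] at this
      exact_mod_cast this
    calc _ ≤ (K : ℝ) ^ (2 * K) * (1 / (K : ℝ)) ^ (2 * K) := by gcongr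
      _ = 1 := by rw [← mul_pow, mul_one_div_cancel hK.ne', one_pow]
      _ = _ := by simp
  | succ n ih =>
    have h1 : (K : ℝ) * (freshMaps p (n + 1)).card +
        ((n + 1) / 2 : ℕ) * (freshMaps p n).card ≤ K * (freshMaps p n).card := by
      exact_mod_cast mul_card_freshMaps_succ_le p n
    have h2 : ((freshMaps p (n + 1)).card : ℝ) ≤
        (1 - ((n + 1) / 2 : ℕ) / (K : ℝ)) * (freshMaps p n).card := by
      rw [← mul_le_mul_iff_right₀ hK]
      have : (K : ℝ) * ((1 - ((n + 1) / 2 : ℕ) / (K : ℝ)) * (freshMaps p n).card) =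
          K * (freshMaps p n).card - ((n + 1) / 2 : ℕ) * (freshMaps p n).card := by
        field_simp
      rw [this]
      linarith
    have h3 : (1 - ((n + 1) / 2 : ℕ) / (K : ℝ)) ≤ Real.exp (-((n + 1) / 2 : ℕ) / K) := by
      have := Real.add_one_le_exp (-(((n + 1) / 2 : ℕ) : ℝ) / K)
      rw [neg_div] at this ⊢
      linarith
    have h4 : (n + 1) ^ 2 / 4 = (n + 1) / 2 + n ^ 2 / 4 := by
      rcases Nat.even_or_odd' n with ⟨m, rfl | rfl⟩
      · have e1 : (2 * m + 1) ^ 2 = 4 * (m ^ 2 + m) + 1 := by ring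
        have e2 : (2 * m) ^ 2 = 4 * m ^ 2 := by ring
        omega
      · have e1 : (2 * m + 1 + 1) ^ 2 = 4 * (m ^ 2 + 2 * m + 1) := by ring
        have e2 : (2 * m + 1) ^ 2 = 4 * (m ^ 2 + m) + 1 := by ring
        omega
    calc _ ≤ (1 - ((n + 1) / 2 : ℕ) / (K : ℝ)) * (freshMaps p n).card *
          (1 / (K : ℝ)) ^ (2 * K) := by gcongr
      _ ≤ Real.exp (-((n + 1) / 2 : ℕ) / K) * (freshMaps p n).card *
          (1 / (K : ℝ)) ^ (2 * K) := by gcongr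
      _ ≤ Real.exp (-((n + 1) / 2 : ℕ) / K) * Real.exp (-((n ^ 2 / 4 : ℕ) : ℝ) / K) := by
          rw [mul_assoc]
          gcongr
      _ = _ := by
          rw [← Real.exp_add, h4]
          congr 1
          push_cast
          ring

lemma sum_exp_neg_sq_le (M : ℕ) :
    ∑ m ∈ Finset.range M, Real.exp (-(1 / (4 * (K : ℝ))) * ((m + 1 : ℕ) : ℝ) ^ 2) ≤
      √(Real.pi * K) := by
  have hK : (0 : ℝ) < K := by exact_mod_cast Nat.pos_of_ne_zero (NeZero.ne K)
  set b : ℝ := 1 / (4 * K) with hb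
  have hb0 : 0 < b := by positivity
  have hanti : AntitoneOn (fun x : ℝ => Real.exp (-b * x ^ 2)) (Set.Icc (0 : ℝ) (0 + M)) := by
    intro x hx y _ hxy
    simp only [Real.exp_le_exp, neg_mul, neg_le_neg_iff]
    have := hx.1
    gcongr
  have h1 := hanti.sum_le_integral
  simp only [zero_add] at h1
  refine h1.trans ?_
  have h2 := integral_gaussian_Ioi b
  have h3 : √(Real.pi / b) / 2 = √(Real.pi * K) := by
    rw [hb, show Real.pi / (1 / (4 * (K : ℝ))) = 2 ^ 2 * (Real.pi * K) by field_simp; ring,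
      Real.sqrt_mul (by norm_num), Real.sqrt_sq (by norm_num)]
    ring
  rw [← h3, ← h2, intervalIntegral.integral_of_le (by positivity)]
  refine setIntegral_mono_set (integrable_exp_neg_mul_sq hb0).integrableOn ?_ ?_
  · exact Eventually.of_forall fun x => (Real.exp_pos _).le
  · exact (Set.Ioc_subset_Ioi_self).eventuallyLE

/-- The path returns after two steps at the time `n + 2` with probability at most
`exp (-n² / (4 * K)) / K`; the sum over `n` is compared to a Gaussian integral. -/
theorem IsRandomGame.measureReal_endsInPair_le {Ω : Type*} [MeasurableSpace Ω] {μ : Measure Ω}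
    [IsProbabilityMeasure μ] {Z : Ω → Payoffs K} (h : IsRandomGame μ Z) (p : Fin 2 × Fin K) :
    μ.real {ω | EndsInPair (bestReply (Z ω)) p} ≤ 1 / (K : ℝ) + √(Real.pi / (K : ℝ)) := by
  classical
  have hK : (0 : ℝ) < K := by exact_mod_cast Nat.pos_of_ne_zero (NeZero.ne K)
  let D : ℕ → Finset (Fin 2 × Fin K → Fin K) := fun n => (freshMaps p (n + 1)).filter fun F =>
    (nextReply F)^[n + 2] p = (nextReply F)^[n] p
  have hsub : {ω | EndsInPair (bestReply (Z ω)) p} ⊆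
      ⋃ n ∈ Finset.range (2 * K + 1), {ω | bestReply (Z ω) ∈ D n} := by
    intro ω hω
    obtain ⟨n, hn, hn'⟩ := EndsInPair.exists_freshMaps hω
    simp only [Set.mem_iUnion]
    refine ⟨n, ?_, Finset.mem_filter.2 ⟨hn, hn'⟩⟩
    have h1 := Finset.card_le_card_of_injOn (s := Finset.Iic (n + 1))
      (t := (Finset.univ : Finset (Fin 2 × Fin K))) _ (fun _ _ => Finset.mem_univ _)
      (by simpa using mem_freshMaps.1 hn)
    simp only [Nat.card_Iic, Finset.card_univ, Fintype.card_prod, Fintype.card_fin] at h1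
    rw [Finset.mem_range]
    omega
  have hterm : ∀ n, μ.real {ω | bestReply (Z ω) ∈ D n} ≤
      1 / K * Real.exp (-(1 / (4 * (K : ℝ))) * (n : ℝ) ^ 2) := by
    intro n
    have h1 : (K : ℝ) * (D n).card = (freshMaps p (n + 1)).card := by
      exact_mod_cast mul_card_freshMaps_filter_return p n
    have h2 := card_freshMaps_le p (n + 1)
    have h3 : ((n : ℝ)) ^ 2 / 4 ≤ (((n + 1) ^ 2 / 4 : ℕ) : ℝ) := by
      have : n ^ 2 ≤ 4 * ((n + 1) ^ 2 / 4) := by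
        have : (n + 1) ^ 2 = n ^ 2 + 2 * n + 1 := by ring
        rcases n.eq_zero_or_pos with rfl | hn
        · simp
        · omega
      have : (n : ℝ) ^ 2 ≤ 4 * (((n + 1) ^ 2 / 4 : ℕ) : ℝ) := by exact_mod_cast this
      linarith
    rw [h.measureReal_bestReply]
    calc _ = 1 / K * ((freshMaps p (n + 1)).card * (1 / (K : ℝ)) ^ (2 * K)) := by
          rw [← h1]; field_simp
      _ ≤ 1 / K * Real.exp (-(((n + 1) ^ 2 / 4 : ℕ) : ℝ) / K) := by gcongr
      _ ≤ _ := by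
          gcongr
          rw [neg_mul, neg_div, neg_le_neg_iff]
          calc _ = ((n : ℝ)) ^ 2 / 4 / K := by field_simp
            _ ≤ _ := by gcongr
  calc _ ≤ μ.real (⋃ n ∈ Finset.range (2 * K + 1), {ω | bestReply (Z ω) ∈ D n}) :=
        measureReal_mono hsub (measure_ne_top _ _)
    _ ≤ ∑ n ∈ Finset.range (2 * K + 1), μ.real {ω | bestReply (Z ω) ∈ D n} :=
        measureReal_biUnion_finset_le _ _
    _ ≤ ∑ n ∈ Finset.range (2 * K + 1),
        1 / K * Real.exp (-(1 / (4 * (K : ℝ))) * (n : ℝ) ^ 2) :=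
        Finset.sum_le_sum fun n _ => hterm n
    _ ≤ 1 / K * (√(Real.pi * K) + 1) := by
        rw [← Finset.mul_sum, Finset.sum_range_succ']
        gcongr
        · exact sum_exp_neg_sq_le _
        · simp
    _ = _ := by
        have : √(Real.pi / K) = √(Real.pi * K) / K := by
          rw [show Real.pi / K = Real.pi * K / K ^ 2 by field_simp, Real.sqrt_div (by positivity),
            Real.sqrt_sq hK.le]
        rw [this]
        ring

end Path

/-! ### The probability that there is no equilibrium -/

section NoEquilibrium

lemma prod_one_sub_le_exp_neg_one {ι : Type*} [Fintype ι] {x : ι → ℝ} (hx1 : ∀ i, x i ≤ 1)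
    (hsum : ∑ i, x i = 1) : ∏ i, (1 - x i) ≤ Real.exp (-1) := by
  calc ∏ i, (1 - x i) ≤ ∏ i, Real.exp (-x i) :=
        Finset.prod_le_prod (fun i _ => sub_nonneg.2 (hx1 i)) fun i _ => by
          linarith [Real.add_one_le_exp (-x i)]
    _ = Real.exp (-1) := by rw [← Real.exp_sum, Finset.sum_neg_distrib, hsum]

lemma one_sub_sum_le_prod_one_sub {ι : Type*} (s : Finset ι) {x : ι → ℝ} (hx0 : ∀ i, 0 ≤ x i)
    (hx1 : ∀ i, x i ≤ 1) : 1 - ∑ i ∈ s, x i ≤ ∏ i ∈ s, (1 - x i) := by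
  classical
  induction s using Finset.induction_on with
  | empty => simp
  | insert a s ha ih =>
    rw [Finset.sum_insert ha, Finset.prod_insert ha]
    have h1 : 0 ≤ ∑ i ∈ s, x i := Finset.sum_nonneg fun i _ => hx0 i
    calc _ ≤ (1 - x a) * (1 - ∑ i ∈ s, x i) := by nlinarith [mul_nonneg (hx0 a) h1]
      _ ≤ _ := mul_le_mul_of_nonneg_left ih (sub_nonneg.2 (hx1 a))

lemma exp_neg_one_mul_le_prod_one_sub {ι : Type*} [Fintype ι] {x : ι → ℝ} (hx0 : ∀ i, 0 ≤ x i)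
    (hx1 : ∀ i, x i ≤ 1) (hsum : ∑ i, x i = 1) :
    Real.exp (-1) * (1 - ∑ i, x i ^ 2) ≤ ∏ i, (1 - x i) := by
  have h1 : 1 - ∑ i, x i ^ 2 ≤ ∏ i, (1 - x i ^ 2) :=
    one_sub_sum_le_prod_one_sub _ (fun i => sq_nonneg _) fun i => pow_le_one₀ (hx0 i) (hx1 i)
  calc Real.exp (-1) * (1 - ∑ i, x i ^ 2) ≤ Real.exp (-1) * ∏ i, (1 - x i ^ 2) := by gcongr
    _ = ∏ i, Real.exp (-x i) * (1 - x i ^ 2) := by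
        rw [Finset.prod_mul_distrib, ← Real.exp_sum, Finset.sum_neg_distrib, hsum]
    _ ≤ ∏ i, (1 - x i) := by
        refine Finset.prod_le_prod (fun i _ => ?_) fun i _ => ?_
        · have := hx0 i
          have := hx1 i
          have : 0 ≤ 1 - x i ^ 2 := by nlinarith
          positivity
        · -- `(1 + x) * exp (-x) ≤ 1`
          have h2 : Real.exp (-x i) * (1 + x i) ≤ 1 := by
            rw [Real.exp_neg, inv_mul_le_one₀ (Real.exp_pos _)]
            linarith [Real.add_one_le_exp (x i)]
          have h3 : 0 ≤ 1 - x i := sub_nonneg.2 (hx1 i)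
          calc _ = Real.exp (-x i) * (1 + x i) * (1 - x i) := by ring
            _ ≤ 1 * (1 - x i) := by gcongr
            _ = _ := one_mul _

variable {K : ℕ}

/-- The number of collisions of a uniformly random mapping is at most `2 * K` on average. -/
lemma sum_sum_card_fiber_sq_le :
    ∑ β : Fin K → Fin K, ∑ b, (Finset.univ.filter fun a => β a = b).card ^ 2 ≤
      2 * K * K ^ K := by
  classical
  have h1 : ∀ β : Fin K → Fin K, ∑ b, (Finset.univ.filter fun a => β a = b).card ^ 2 =
      ∑ a, ∑ a', if β a = β a' then 1 else 0 := by
    intro β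
    have : ∀ b, (Finset.univ.filter fun a => β a = b).card ^ 2 =
        ∑ a, ∑ a', if β a = b ∧ β a' = b then 1 else 0 := by
      intro b
      rw [sq, Finset.card_filter, Finset.sum_mul_sum]
      refine Finset.sum_congr rfl fun a _ => Finset.sum_congr rfl fun a' _ => ?_
      split_ifs <;> simp_all
    simp only [this]
    rw [Finset.sum_comm]
    refine Finset.sum_congr rfl fun a _ => ?_
    rw [Finset.sum_comm]
    refine Finset.sum_congr rfl fun a' _ => ?_
    rw [Finset.sum_eq_single (β a)]
    · simp [eq_comm]
    · intro b _ hb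
      rw [if_neg]
      rintro ⟨rfl, _⟩
      exact hb rfl
    · simp
  simp only [h1]
  rw [Finset.sum_comm]
  have h2 : ∀ a : Fin K, ∑ β : Fin K → Fin K, ∑ a', (if β a = β a' then 1 else 0) ≤
      2 * K ^ K := by
    intro a
    have h3 : ∀ a', a' ≠ a → K * ∑ β : Fin K → Fin K, (if β a = β a' then 1 else 0) = K ^ K := by
      intro a' ha
      have := card_mul_card_filter_apply_mem (Finset.univ : Finset (Fin K → Fin K))
        (fun _ => a) (fun β => {β a'}) (by simp) (by simp) (by simp [ha])
      rw [← Finset.card_filter]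
      simpa using this
    rw [Finset.sum_comm, ← Finset.add_sum_erase _ _ (Finset.mem_univ a)]
    have hK : 0 < K := a.pos
    refine le_of_mul_le_mul_left ?_ hK
    rw [mul_add, Finset.mul_sum (s := Finset.univ.erase a),
      Finset.sum_congr rfl fun a' ha' => h3 a' (Finset.ne_of_mem_erase ha')]
    simp only [if_true, Finset.sum_const, Finset.card_univ, smul_eq_mul, mul_one, Fintype.card_fun,
      Fintype.card_fin, Finset.card_erase_of_mem (Finset.mem_univ a)]
    have : (K - 1) * K ^ K ≤ K * K ^ K := Nat.mul_le_mul_right _ (Nat.sub_le _ _)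
    linarith
  refine (Finset.sum_le_sum fun a _ => h2 a).trans_eq ?_
  rw [Finset.sum_const, Finset.card_univ, Fintype.card_fin, smul_eq_mul]
  ring

/-- Given the best replies `β` of player `1`, there is no mutual best reply if and only if the best
replies of player `0` to the different `b` avoid the sets `β ⁻¹' {b}`. -/
lemma card_no_mutual_reply :
    (Finset.univ.filter fun f : Fin 2 × Fin K → Fin K => ∀ a, f (0, f (1, a)) ≠ a).card =
      ∑ β : Fin K → Fin K, ∏ b, (Finset.univ.filter fun a => β a ≠ b).card := by
  classical
  simp only [← Fintype.card_piFinset]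
  rw [← Finset.card_sigma]
  refine Finset.card_bij' (i := fun f _ => (⟨fun a => f (1, a), fun b => f (0, b)⟩ :
      Σ _ : Fin K → Fin K, Fin K → Fin K))
    (j := fun q _ => fun p => if p.1 = 0 then q.2 p.2 else q.1 p.2) ?_ ?_ ?_ ?_
  · intro f hf
    simp only [Finset.mem_filter, Finset.mem_univ, true_and] at hf
    simp only [Finset.mem_sigma, Finset.mem_univ, Fintype.mem_piFinset, Finset.mem_filter,
      true_and]
    intro b hb
    exact hf (f (0, b)) (by rw [hb])
  · rintro ⟨β, α⟩ hq
    simp only [Finset.mem_sigma, Finset.mem_univ, Fintype.mem_piFinset, Finset.mem_filter,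
      true_and] at hq
    simp only [Finset.mem_filter, Finset.mem_univ, true_and, if_true, one_ne_zero, if_false]
    intro a ha
    exact hq (β a) (by rw [ha])
  · intro f _
    ext ⟨i, x⟩
    fin_cases i <;> simp
  · rintro ⟨β, α⟩ _
    simp

variable [NeZero K]

lemma NoTies.exists_isPNE_iff {z : Payoffs K} (hz : NoTies z) :
    (∃ s, IsPNE z s) ↔ ∃ a, bestReply z (0, bestReply z (1, a)) = a := by
  simp only [hz.isPNE_iff, Fin.forall_fin_two]
  constructor
  · rintro ⟨s, h0, h1⟩
    refine ⟨s 0, ?_⟩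
    simp only [sub_zero, sub_self] at h0 h1
    rw [h1, h0]
  · rintro ⟨a, ha⟩
    exact ⟨replyProfile 0 a (bestReply z (1, a)), by simpa [replyProfile] using ha,
      by simp [replyProfile]⟩

/-- The probability that there is no equilibrium is the mean of `∏ (1 - n_b / K)`, where `n_b` is
the number of strategies of player `0` to which `b` is the best reply. It is at most `1 / e`, and
the difference is controlled by the mean of `∑ (n_b / K)²`. -/
theorem IsRandomGame.measureReal_compl_pneEvent {Ω : Type*} [MeasurableSpace Ω] {μ : Measure Ω}
    [IsProbabilityMeasure μ] {Z : Ω → Payoffs K} (h : IsRandomGame μ Z) :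
    Real.exp (-1) * (1 - 2 / K) ≤ μ.real (pneEvent Z)ᶜ ∧
      μ.real (pneEvent Z)ᶜ ≤ Real.exp (-1) := by
  classical
  have hK : (0 : ℝ) < K := by exact_mod_cast Nat.pos_of_ne_zero (NeZero.ne K)
  let N : (Fin K → Fin K) → Fin K → ℕ := fun β b => (Finset.univ.filter fun a => β a = b).card
  have hN : ∀ β b, ((Finset.univ.filter fun a => β a ≠ b).card : ℝ) = K * (1 - N β b / K) := by
    intro β b
    have := Finset.card_filter_add_card_filter_not (s := (Finset.univ : Finset (Fin K)))
      (fun a => β a = b)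
    rw [Finset.card_univ, Fintype.card_fin] at this
    have h2 : (N β b : ℝ) + (Finset.univ.filter fun a => β a ≠ b).card = K := by
      exact_mod_cast this
    rw [mul_sub, mul_div_cancel₀ _ hK.ne']
    linarith
  have hN0 : ∀ β b, 0 ≤ (N β b : ℝ) / K := fun β b => by positivity
  have hN1 : ∀ β b, (N β b : ℝ) / K ≤ 1 := by
    intro β b
    rw [div_le_one hK]
    have := Finset.card_le_univ (Finset.univ.filter fun a => β a = b)
    rw [Fintype.card_fin] at this
    exact_mod_cast this
  have hNsum : ∀ β, ∑ b, (N β b : ℝ) / K = 1 := by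
    intro β
    rw [← Finset.sum_div, div_eq_one_iff_eq hK.ne']
    have := Finset.card_eq_sum_card_fiberwise (s := (Finset.univ : Finset (Fin K)))
      (t := Finset.univ) (f := β) (by simp)
    rw [Finset.card_univ, Fintype.card_fin] at this
    exact_mod_cast this.symm
  have hprob : μ.real (pneEvent Z)ᶜ =
      ∑ β : Fin K → Fin K, (1 / (K : ℝ)) ^ K * ∏ b, (1 - (N β b : ℝ) / K) := by
    have h1 : μ.real (pneEvent Z)ᶜ = μ.real {ω | bestReply (Z ω) ∈
        Finset.univ.filter fun f : Fin 2 × Fin K → Fin K => ∀ a, f (0, f (1, a)) ≠ a} := by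
      refine measureReal_congr ?_
      filter_upwards [h.ae_noTies] with ω hω
      refine propext ?_
      change ¬ (∃ s, IsPNE (Z ω) s) ↔ bestReply (Z ω) ∈ _
      rw [hω.exists_isPNE_iff]
      simp
    rw [h1, h.measureReal_bestReply, card_no_mutual_reply]
    push_cast
    rw [Finset.sum_mul]
    refine Finset.sum_congr rfl fun β _ => ?_
    simp only [hN, Finset.prod_mul_distrib, Finset.prod_const, Finset.card_univ, Fintype.card_fin]
    rw [two_mul, pow_add]
    have : (K : ℝ) ^ K * (1 / (K : ℝ)) ^ K = 1 := by
      rw [← mul_pow, mul_one_div_cancel hK.ne', one_pow]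
    linear_combination ((1 / (K : ℝ)) ^ K * ∏ b, (1 - (N β b : ℝ) / K)) * this
  have hone : ∑ β : Fin K → Fin K, (1 / (K : ℝ)) ^ K = 1 := by
    rw [Finset.sum_const, Finset.card_univ, Fintype.card_fun, Fintype.card_fin, nsmul_eq_mul]
    push_cast
    rw [← mul_pow, mul_one_div_cancel hK.ne', one_pow]
  rw [hprob]
  constructor
  · have hsq : ∑ β : Fin K → Fin K, (1 / (K : ℝ)) ^ K * ∑ b, ((N β b : ℝ) / K) ^ 2 ≤ 2 / K := by
      have h1 : ∑ β : Fin K → Fin K, ∑ b, (N β b : ℝ) ^ 2 ≤ 2 * K * (K : ℝ) ^ K := by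
        exact_mod_cast sum_sum_card_fiber_sq_le (K := K)
      have h2 : ∑ β : Fin K → Fin K, (1 / (K : ℝ)) ^ K * ∑ b, ((N β b : ℝ) / K) ^ 2 =
          (1 / (K : ℝ)) ^ K / K ^ 2 * ∑ β : Fin K → Fin K, ∑ b, (N β b : ℝ) ^ 2 := by
        rw [Finset.mul_sum]
        refine Finset.sum_congr rfl fun β _ => ?_
        simp only [div_pow]
        rw [← Finset.sum_div]
        ring
      rw [h2]
      calc _ ≤ (1 / (K : ℝ)) ^ K / K ^ 2 * (2 * K * (K : ℝ) ^ K) := by gcongr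
        _ = 2 / K * ((1 / (K : ℝ)) * K) ^ K := by rw [mul_pow]; field_simp
        _ = _ := by rw [one_div_mul_cancel hK.ne', one_pow, mul_one]
    calc _ ≤ Real.exp (-1) * (1 - ∑ β : Fin K → Fin K, (1 / (K : ℝ)) ^ K *
          ∑ b, ((N β b : ℝ) / K) ^ 2) := by gcongr
      _ = ∑ β : Fin K → Fin K, (1 / (K : ℝ)) ^ K *
          (Real.exp (-1) * (1 - ∑ b, ((N β b : ℝ) / K) ^ 2)) := by
          have : ∀ β : Fin K → Fin K, (1 / (K : ℝ)) ^ K *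
              (Real.exp (-1) * (1 - ∑ b, ((N β b : ℝ) / K) ^ 2)) =
              Real.exp (-1) * (1 / (K : ℝ)) ^ K -
                Real.exp (-1) * ((1 / (K : ℝ)) ^ K * ∑ b, ((N β b : ℝ) / K) ^ 2) := fun β => by
            ring
          have h2 : ∑ β : Fin K → Fin K, Real.exp (-1) * (1 / (K : ℝ)) ^ K = Real.exp (-1) := by
            rw [← Finset.mul_sum, hone, mul_one]
          rw [mul_sub, mul_one, Finset.mul_sum, Finset.sum_congr rfl fun β _ => this β,
            Finset.sum_sub_distrib, h2]
      _ ≤ _ := by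
          gcongr with β _
          exact exp_neg_one_mul_le_prod_one_sub (hN0 β) (hN1 β) (hNsum β)
  · calc _ ≤ ∑ β : Fin K → Fin K, (1 / (K : ℝ)) ^ K * Real.exp (-1) := by
          gcongr with β _
          exact prod_one_sub_le_exp_neg_one (hN1 β) (hNsum β)
      _ = _ := by rw [← Finset.sum_mul, hone, one_mul]

end NoEquilibrium

/-! ### Traps are rare -/

section Traps

variable {K : ℕ}

/-- What a trap with `α`, with the set `G` of improvements of player `0` on `(a, b)`, and with the
set `G'` of improvements of player `1` on `(α, b)` requires of the single blocks. -/
def TrapBlocks (a₀ b₀ a b α : Fin K) (G G' : Finset (Fin K)) (p : Fin 2 × Fin K)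
    (v : Fin K → ℝ) : Prop :=
  if p.1 = 0 then
    (p.2 = b₀ → ∀ y, v y ≤ v a₀) ∧ (p.2 = b → above v a = G ∧ ∀ y, v y ≤ v α) ∧
      (p.2 ∈ G' → v a₀ < v α)
  else
    ((p.2 = a₀ → ∀ y, v y ≤ v b₀) ∧ (p.2 = a → ∀ y, v y ≤ v b)) ∧ (p.2 = α → above v b = G') ∧
      (p.2 ∈ G.erase α → v b₀ < v b)

lemma measurable_trapBlocks (a₀ b₀ a b α : Fin K) (G G' : Finset (Fin K)) (p : Fin 2 × Fin K) :
    Measurable (TrapBlocks a₀ b₀ a b α G G' p) := by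
  unfold TrapBlocks
  split_ifs
  · exact (measurable_const.imp (measurable_isTop _)).and
      ((measurable_const.imp ((measurable_above_eq _ _).and (measurable_isTop _))).and
        (measurable_const.imp (measurable_lt_apply _ _)))
  · exact ((measurable_const.imp (measurable_isTop _)).and
      (measurable_const.imp (measurable_isTop _))).and
      ((measurable_const.imp (measurable_above_eq _ _)).and
        (measurable_const.imp (measurable_lt_apply _ _)))

/-- The blocks named in `TrapBlocks` are different from each other. -/
def TrapIndices (a₀ b₀ a b α : Fin K) (G G' : Finset (Fin K)) : Prop :=
  a ≠ a₀ ∧ b ≠ b₀ ∧ α ∈ G ∧ a ∉ G ∧ a₀ ∉ G ∧ b ∉ G' ∧ b₀ ∉ G'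

lemma IsTrap.exists_trapBlocks {z : Payoffs K} {a₀ b₀ a b α : Fin K}
    (h : IsTrap z a₀ b₀ a b α) :
    ∃ G G', TrapIndices a₀ b₀ a b α G G' ∧
      ∀ p, TrapBlocks a₀ b₀ a b α G G' p (payoffBlock z p) := by
  refine ⟨above (payoffBlock z (0, b)) a, above (payoffBlock z (1, α)) b,
    ⟨h.ne_row, h.ne_col, by simpa using h.lt, by simp, fun hmem => ?_, by simp, fun hmem => ?_⟩,
    ?_⟩
  · exact (h.avoid_col a₀ (by simpa using hmem)).1 rfl
  · exact (h.avoid_row b₀ (by simpa using hmem)).1 rfl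
  · rintro ⟨i, x⟩
    unfold TrapBlocks
    split_ifs with hi
    · obtain rfl : i = 0 := hi
      refine ⟨?_, ?_, ?_⟩
      · rintro rfl
        exact h.best_col
      · rintro rfl
        exact ⟨rfl, h.best_col'⟩
      · intro hx
        exact (h.avoid_row x (by simpa using hx)).2
    · obtain rfl : i = 1 := (eq_or_eq_one_sub 0 i).resolve_left hi
      refine ⟨⟨?_, ?_⟩, ?_, ?_⟩
      · rintro rfl
        exact h.best_row
      · rintro rfl
        exact h.best_row'
      · rintro rfl
        rfl
      · intro hx
        exact (h.avoid_col x (by simpa using Finset.mem_of_mem_erase hx)).2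

lemma prod_ite_mem_const (s : Finset (Fin K)) (c : ℝ) :
    ∏ x, (if x ∈ s then c else 1) = c ^ s.card := by
  rw [Finset.prod_ite_mem, Finset.univ_inter, Finset.prod_const]

section

variable {ν : Measure ℝ} [IsProbabilityMeasure ν] (hν : ∀ x, ν {x} = 0)

include hν

lemma prod_measureReal_trapBlocks_le {a₀ b₀ a b α : Fin K} {G G' : Finset (Fin K)}
    (h : TrapIndices a₀ b₀ a b α G G') :
    ∏ p, (Measure.pi fun _ : Fin K => ν).real {v | TrapBlocks a₀ b₀ a b α G G' p v} ≤
      (1 / (K : ℝ)) ^ 3 *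
        ((Measure.pi fun _ : Fin K => ν).real {v | above v b = G'} * (1 / 2) ^ G'.card) *
        ((Measure.pi fun _ : Fin K => ν).real {v | above v a = G ∧ ∀ y, v y ≤ v α} *
          (2 * (1 / 2) ^ G.card)) := by
  obtain ⟨h1, h2, h3, h4, h5, h6, h7⟩ := h
  set ρ := Measure.pi fun _ : Fin K => ν with hρ
  have hαa : α ≠ a := fun h => h4 (h ▸ h3)
  have hαa₀ : α ≠ a₀ := fun h => h5 (h ▸ h3)
  have hcol : ∏ x, ρ.real {v | TrapBlocks a₀ b₀ a b α G G' (0, x) v} ≤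
      ∏ x, ((if x = b₀ then 1 / (K : ℝ) else 1) *
        (if x = b then ρ.real {v | above v a = G ∧ ∀ y, v y ≤ v α} else 1) *
        (if x ∈ G' then 1 / 2 else 1)) := by
    refine Finset.prod_le_prod (fun _ _ => measureReal_nonneg) fun x _ => ?_
    simp only [TrapBlocks, if_true]
    by_cases hx0 : x = b₀
    · rw [if_pos hx0, if_neg (hx0 ▸ h2.symm), if_neg (hx0 ▸ h7), mul_one, mul_one,
        ← measureReal_isTop hν a₀]
      exact measureReal_mono (fun v hv => hv.1 hx0) (measure_ne_top _ _)
    by_cases hx1 : x = b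
    · rw [if_neg hx0, if_pos hx1, if_neg (hx1 ▸ h6), mul_one, one_mul]
      exact measureReal_mono (fun v hv => hv.2.1 hx1) (measure_ne_top _ _)
    by_cases hx2 : x ∈ G'
    · rw [if_neg hx0, if_neg hx1, if_pos hx2, one_mul, one_mul]
      exact (measureReal_mono (fun v hv => hv.2.2 hx2) (measure_ne_top _ _)).trans
        (measureReal_lt_le ν a₀ α)
    rw [if_neg hx0, if_neg hx1, if_neg hx2, one_mul, one_mul]
    exact measureReal_le_one
  have hrow : ∏ x, ρ.real {v | TrapBlocks a₀ b₀ a b α G G' (1, x) v} ≤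
      ∏ x, ((if x = a₀ then 1 / (K : ℝ) else 1) * (if x = a then 1 / (K : ℝ) else 1) *
        (if x = α then ρ.real {v | above v b = G'} else 1) *
        (if x ∈ G.erase α then 1 / 2 else 1)) := by
    refine Finset.prod_le_prod (fun _ _ => measureReal_nonneg) fun x _ => ?_
    simp only [TrapBlocks, one_ne_zero, if_false]
    by_cases hx0 : x = a₀
    · rw [if_pos hx0, if_neg (hx0 ▸ h1.symm), if_neg (hx0 ▸ hαa₀.symm),
        if_neg (hx0 ▸ fun h => h5 (Finset.mem_of_mem_erase h)), mul_one, mul_one, mul_one,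
        ← measureReal_isTop hν b₀]
      exact measureReal_mono (fun v hv => hv.1.1 hx0) (measure_ne_top _ _)
    by_cases hx1 : x = a
    · rw [if_neg hx0, if_pos hx1, if_neg (hx1 ▸ hαa.symm),
        if_neg (hx1 ▸ fun h => h4 (Finset.mem_of_mem_erase h)), mul_one, mul_one, one_mul,
        ← measureReal_isTop hν b]
      exact measureReal_mono (fun v hv => hv.1.2 hx1) (measure_ne_top _ _)
    by_cases hx2 : x = α
    · rw [if_neg hx0, if_neg hx1, if_pos hx2, if_neg (hx2 ▸ Finset.notMem_erase _ _), one_mul,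
        one_mul, mul_one]
      exact measureReal_mono (fun v hv => hv.2.1 hx2) (measure_ne_top _ _)
    by_cases hx3 : x ∈ G.erase α
    · rw [if_neg hx0, if_neg hx1, if_neg hx2, if_pos hx3, one_mul, one_mul, one_mul]
      exact (measureReal_mono (fun v hv => hv.2.2 hx3) (measure_ne_top _ _)).trans
        (measureReal_lt_le ν b₀ b)
    rw [if_neg hx0, if_neg hx1, if_neg hx2, if_neg hx3, one_mul, one_mul, one_mul]
    exact measureReal_le_one
  rw [Fintype.prod_prod_type, Fin.prod_univ_two]
  refine (mul_le_mul hcol hrow (Finset.prod_nonneg fun _ _ => measureReal_nonneg)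
    (hcol.trans' (Finset.prod_nonneg fun _ _ => measureReal_nonneg))).trans_eq ?_
  simp only [Finset.prod_mul_distrib, Finset.prod_ite_eq', Finset.mem_univ, if_true,
    prod_ite_mem_const]
  have hG : (1 / 2 : ℝ) ^ (G.erase α).card = 2 * (1 / 2) ^ G.card := by
    rw [← Finset.card_erase_add_one h3, pow_succ]
    ring
  rw [hG]
  ring

end

variable [NeZero K] {Ω : Type*} [MeasurableSpace Ω] {μ : Measure Ω} [IsProbabilityMeasure μ]
  {Z : Ω → Payoffs K}

/-- The blocks being independent, the probability of a trap is bounded block by block, and summed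
over the possible sets of improvements. -/
lemma IsRandomGame.measureReal_isTrap_le (h : IsRandomGame μ Z) (a₀ b₀ a b : Fin K) :
    μ.real {ω | ∃ α, IsTrap (Z ω) a₀ b₀ a b α} ≤ 8 / (K : ℝ) ^ 5 := by
  obtain ⟨-, ν, hν, hν0, hmap⟩ := h.blocks
  have hK : (0 : ℝ) < K := by exact_mod_cast Nat.pos_of_ne_zero (NeZero.ne K)
  set ρ := Measure.pi fun _ : Fin K => ν with hρ
  let E : Fin K → Finset (Fin K) → Finset (Fin K) → Set Ω := fun α G G' =>
    {ω | TrapIndices a₀ b₀ a b α G G' ∧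
      ∀ p, TrapBlocks a₀ b₀ a b α G G' p (payoffBlock (Z ω) p)}
  let r : Finset (Fin K) → ℝ := fun G' => ρ.real {v | above v b = G'} * (1 / 2) ^ G'.card
  let q : Fin K → Finset (Fin K) → ℝ := fun α G =>
    ρ.real {v | above v a = G ∧ ∀ y, v y ≤ v α} * (2 * (1 / 2) ^ G.card)
  have hE : ∀ α G G', μ.real (E α G G') ≤ (1 / (K : ℝ)) ^ 3 * r G' * q α G := by
    intro α G G'
    by_cases hi : TrapIndices a₀ b₀ a b α G G'
    · have h1 : E α G G' =
          {ω | ∀ p, TrapBlocks a₀ b₀ a b α G G' p (payoffBlock (Z ω) p)} := by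
        ext ω
        simp [E, hi]
      rw [h1, h.measureReal_forall (measurable_trapBlocks a₀ b₀ a b α G G'),
        Finset.prod_congr rfl fun p _ => measureReal_payoffBlock h (hmap p)
          (measurable_trapBlocks a₀ b₀ a b α G G' p)]
      exact prod_measureReal_trapBlocks_le hν0 hi
    · have h1 : E α G G' = ∅ := by
        ext ω
        simp [E, hi]
      rw [h1, measureReal_empty]
      positivity
  have hr : ∑ G', r G' ≤ 2 / K := sum_measureReal_above_mul_le hν0 b
  have hq : ∑ G, ∑ α, q α G ≤ 4 / K := by
    calc ∑ G, ∑ α, q α G ≤ ∑ G : Finset (Fin K),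
          2 * (ρ.real {v | above v a = G} * (1 / 2) ^ G.card) := by
          refine Finset.sum_le_sum fun G _ => ?_
          rw [← Finset.sum_mul, mul_left_comm]
          gcongr
          exact sum_measureReal_above_isTop_le hν0 a G
      _ ≤ 2 * (2 / K) := by
          rw [← Finset.mul_sum]
          gcongr
          exact sum_measureReal_above_mul_le hν0 a
      _ = 4 / K := by ring
  have hsub : {ω | ∃ α, IsTrap (Z ω) a₀ b₀ a b α} ⊆
      ⋃ q : (Finset (Fin K) × Fin K) × Finset (Fin K), E q.1.2 q.1.1 q.2 := by
    rintro ω ⟨α, hα⟩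
    obtain ⟨G, G', hi, hp⟩ := hα.exists_trapBlocks
    exact Set.mem_iUnion.2 ⟨((G, α), G'), hi, hp⟩
  calc _ ≤ ∑ q : (Finset (Fin K) × Fin K) × Finset (Fin K), μ.real (E q.1.2 q.1.1 q.2) :=
        (measureReal_mono hsub (measure_ne_top _ _)).trans (measureReal_iUnion_fintype_le _)
    _ ≤ ∑ x : (Finset (Fin K) × Fin K) × Finset (Fin K),
        (1 / (K : ℝ)) ^ 3 * r x.2 * q x.1.2 x.1.1 := Finset.sum_le_sum fun _ _ => hE _ _ _
    _ = (1 / (K : ℝ)) ^ 3 * (∑ G', r G') * ∑ G, ∑ α, q α G := by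
        rw [Fintype.sum_prod_type, Fintype.sum_prod_type]
        simp only [← Finset.sum_mul, ← Finset.mul_sum]
    _ ≤ (1 / (K : ℝ)) ^ 3 * (2 / K) * (4 / K) := by
        have hr0 : 0 ≤ ∑ G', r G' := Finset.sum_nonneg fun _ _ => by positivity
        gcongr
    _ = 8 / (K : ℝ) ^ 5 := by
        field_simp
        norm_num

/-- Of the probability of order `K⁻⁵` of a trap with given `a₀, b₀, a, b`, a factor `K⁻²` stems from
the equilibrium, a factor `K⁻¹` from `b` being the best reply to `a`, and a factor of order `K⁻¹`
from each of the two sets of improvements: the number of improvements is uniformly distributed,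
and each of them has to satisfy an independent condition of probability at most `1 / 2`. -/
theorem IsRandomGame.measureReal_exists_isTrap_le (h : IsRandomGame μ Z) :
    μ.real {ω | ∃ a₀ b₀ a b α, IsTrap (Z ω) a₀ b₀ a b α} ≤ 8 / (K : ℝ) := by
  have hK : (0 : ℝ) < K := by exact_mod_cast Nat.pos_of_ne_zero (NeZero.ne K)
  have hset : {ω | ∃ a₀ b₀ a b α, IsTrap (Z ω) a₀ b₀ a b α} =
      ⋃ x : (Fin K × Fin K) × Fin K × Fin K,
        {ω | ∃ α, IsTrap (Z ω) x.1.1 x.1.2 x.2.1 x.2.2 α} := by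
    ext ω
    simp
  rw [hset]
  calc _ ≤ ∑ x : (Fin K × Fin K) × Fin K × Fin K,
        μ.real {ω | ∃ α, IsTrap (Z ω) x.1.1 x.1.2 x.2.1 x.2.2 α} :=
        measureReal_iUnion_fintype_le _
    _ ≤ ∑ _x : (Fin K × Fin K) × Fin K × Fin K, 8 / (K : ℝ) ^ 5 :=
        Finset.sum_le_sum fun x _ => h.measureReal_isTrap_le _ _ _ _
    _ = 8 / (K : ℝ) := by
        rw [Finset.sum_const, Finset.card_univ]
        simp only [Fintype.card_prod, Fintype.card_fin, nsmul_eq_mul]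
        push_cast
        field_simp

end Traps

/-! ### Convergence of the two dynamics -/

section Convergence

lemma convergenceEvent_betterResponses_subset {Ω : Type*} {K : ℕ} (Z : Ω → Payoffs K)
    (X : ℕ → Ω → Profile K) : convergenceEvent betterResponses Z X ⊆ pneEvent Z := by
  rintro ω ⟨n, hn⟩
  exact ⟨X n ω, isPNE_of_betterResponses_eq_empty hn⟩

variable {K : ℕ} [NeZero K] {Ω : Type*} [MeasurableSpace Ω] {μ : Measure Ω}
  [IsProbabilityMeasure μ] {Z : Ω → Payoffs K} {X : ℕ → Ω → Profile K}

lemma measureReal_convergenceEvent_bestResponses_le (hZ : IsRandomGame μ Z)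
    (hX : IsResponseDynamics bestResponses μ Z X) :
    μ.real (convergenceEvent bestResponses Z X) ≤ 1 / (K : ℝ) + √(Real.pi / (K : ℝ)) := by
  classical
  let S : Fin 2 → Set Ω := fun i => {ω | EndsInPair (bestReply (Z ω)) (i, 0)}
  have h1 : μ (convergenceEvent bestResponses Z X) ≤ ∑ i, 2⁻¹ * μ (S i) := by
    rw [hX.measure_convergence measurableSet_bestResponses_eq hZ.measurable_payoffs]
    calc _ ≤ ∫⁻ ω, ∑ i, 2⁻¹ * (toMeasurable μ (S i)).indicator 1 ω ∂μ := by
          refine lintegral_mono_ae ?_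
          filter_upwards [hZ.ae_noTies] with ω hω
          refine iSup_le fun n => (absorbedProb_bestResponses_start_le hω n).trans ?_
          refine Finset.sum_le_sum fun i _ => mul_le_mul_right ?_ _
          split_ifs with h
          · rw [Set.indicator_of_mem (subset_toMeasurable μ (S i) h)]
            exact le_rfl
          · exact zero_le
      _ = ∑ i, 2⁻¹ * μ (S i) := by
          have hm : ∀ i, Measurable ((toMeasurable μ (S i)).indicator (1 : Ω → ℝ≥0∞)) :=
            fun i => measurable_one.indicator (measurableSet_toMeasurable _ _)
          rw [lintegral_finsetSum _ fun i _ => (hm i).const_mul _]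
          refine Finset.sum_congr rfl fun i _ => ?_
          rw [lintegral_const_mul _ (hm i), lintegral_indicator_one (measurableSet_toMeasurable _ _),
            measure_toMeasurable]
  have h2 : μ.real (convergenceEvent bestResponses Z X) ≤ ∑ i, 2⁻¹ * μ.real (S i) := by
    have h3 := ENNReal.toReal_mono (ENNReal.sum_ne_top.2 fun i _ =>
      ENNReal.mul_ne_top (by simp) (measure_ne_top _ _)) h1
    rw [ENNReal.toReal_sum fun i _ => ENNReal.mul_ne_top (by simp) (measure_ne_top _ _)] at h3
    simpa [measureReal_def] using h3
  rw [Fin.sum_univ_two] at h2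
  have h3 := hZ.measureReal_endsInPair_le (0, 0)
  have h4 := hZ.measureReal_endsInPair_le (1, 0)
  simp only [S] at h2
  linarith

/-- Up to an event of probability at most `8 / K`, the better-response dynamics converges if there
is an equilibrium. -/
lemma measureReal_pneEvent_le (hZ : IsRandomGame μ Z)
    (hX : IsResponseDynamics betterResponses μ Z X) :
    μ.real (pneEvent Z) ≤ μ.real (convergenceEvent betterResponses Z X) + 8 / (K : ℝ) := by
  classical
  set T : Set Ω := {ω | ∃ a₀ b₀ a b α, IsTrap (Z ω) a₀ b₀ a b α} with hT
  have h1 : μ (pneEvent Z) ≤ μ (convergenceEvent betterResponses Z X) + μ T := by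
    rw [hX.measure_convergence measurableSet_betterResponses_eq hZ.measurable_payoffs]
    calc μ (pneEvent Z) = ∫⁻ ω, (pneEvent Z).indicator 1 ω ∂μ :=
          (lintegral_indicator_one (measurableSet_pneEvent hZ)).symm
      _ ≤ ∫⁻ ω, ((⨆ n, absorbedProb (betterResponses (Z ω)) (fun _ => 0) n) +
          (toMeasurable μ T).indicator 1 ω) ∂μ := by
          refine lintegral_mono_ae ?_
          filter_upwards [hZ.ae_noTies] with ω hω
          by_cases hE : ω ∈ pneEvent Z
          · rw [Set.indicator_of_mem hE]
            by_cases hωT : ω ∈ T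
            · rw [Set.indicator_of_mem (subset_toMeasurable μ T hωT)]
              exact le_add_self
            · rw [iSup_absorbedProb_betterResponses hω hE
                fun a₀ b₀ a b α h => hωT ⟨a₀, b₀, a, b, α, h⟩]
              exact le_self_add
          · rw [Set.indicator_of_notMem hE]
            exact zero_le
      _ = _ := by
          rw [lintegral_add_right _ (measurable_one.indicator (measurableSet_toMeasurable _ _)),
            lintegral_indicator_one (measurableSet_toMeasurable _ _), measure_toMeasurable]
  have h2 := ENNReal.toReal_mono (ENNReal.add_ne_top.2
    ⟨measure_ne_top _ _, measure_ne_top _ _⟩) h1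
  rw [ENNReal.toReal_add (measure_ne_top _ _) (measure_ne_top _ _)] at h2
  simp only [← measureReal_def] at h2
  linarith [hZ.measureReal_exists_isTrap_le]

lemma exp_neg_one_le_half : Real.exp (-1) ≤ 1 / 2 := by
  rw [Real.exp_neg, ← one_div]
  exact one_div_le_one_div_of_le two_pos (by linarith [Real.exp_one_gt_d9])

lemma abs_measureReal_convergenceEvent_betterResponses_sub_le (hZ : IsRandomGame μ Z)
    (hX : IsResponseDynamics betterResponses μ Z X) :
    |μ.real (convergenceEvent betterResponses Z X) - (1 - Real.exp (-1))| ≤ 8 / (K : ℝ) := by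
  have hK : (0 : ℝ) < K := by exact_mod_cast Nat.pos_of_ne_zero (NeZero.ne K)
  obtain ⟨h1, h2⟩ := hZ.measureReal_compl_pneEvent
  rw [probReal_compl_eq_one_sub (measurableSet_pneEvent hZ)] at h1 h2
  have h3 : μ.real (convergenceEvent betterResponses Z X) ≤ μ.real (pneEvent Z) :=
    measureReal_mono (convergenceEvent_betterResponses_subset Z X) (measure_ne_top _ _)
  have h4 := measureReal_pneEvent_le hZ hX
  have h5 : Real.exp (-1) * (2 / K) ≤ 8 / K := by
    calc _ ≤ 1 / 2 * (2 / (K : ℝ)) := by gcongr; exact exp_neg_one_le_half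
      _ = 1 / K := by ring
      _ ≤ _ := by gcongr; norm_num
  rw [abs_le]
  constructor
  · linarith
  · rw [mul_sub] at h1
    linarith

lemma one_sub_le_cond_real_convergenceEvent (hZ : IsRandomGame μ Z)
    (hX : IsResponseDynamics betterResponses μ Z X) :
    1 - 16 / (K : ℝ) ≤ (cond μ (pneEvent Z)).real (convergenceEvent betterResponses Z X) := by
  have hK : (0 : ℝ) < K := by exact_mod_cast Nat.pos_of_ne_zero (NeZero.ne K)
  have h2 := hZ.measureReal_compl_pneEvent.2
  rw [probReal_compl_eq_one_sub (measurableSet_pneEvent hZ)] at h2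
  have h3 : 1 / 2 ≤ μ.real (pneEvent Z) := by linarith [exp_neg_one_le_half]
  have h4 := measureReal_pneEvent_le hZ hX
  rw [measureReal_def, cond_apply (measurableSet_pneEvent hZ), Set.inter_eq_right.2
    (convergenceEvent_betterResponses_subset Z X), ENNReal.toReal_mul, ENNReal.toReal_inv,
    ← measureReal_def, ← measureReal_def, ← div_eq_inv_mul, le_div_iff₀ (by linarith)]
  have h5 : 8 / (K : ℝ) ≤ 16 / K * μ.real (pneEvent Z) := by
    calc 8 / (K : ℝ) = 16 / K * (1 / 2) := by ring
      _ ≤ _ := by gcongr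
  linarith

end Convergence

theorem theorem1 :
    ∃ C : ℝ, ∀ (Ω : ℕ+ → Type*) [∀ K, MeasurableSpace (Ω K)] (μ : ∀ K, Measure (Ω K))
      [∀ K, IsProbabilityMeasure (μ K)] (Z : ∀ K : ℕ+, Ω K → Payoffs (K : ℕ)),
      (∀ K, IsRandomGame (μ K) (Z K)) →
      -- best-response dynamics
      (∀ X : ∀ K : ℕ+, ℕ → Ω K → Profile (K : ℕ),
        (∀ K, IsResponseDynamics bestResponses (μ K) (Z K) (X K)) →
          Tendsto (fun K => (μ K).real (convergenceEvent bestResponses (Z K) (X K))ᶜ)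
            atTop (𝓝 1) ∧
          ∀ K : ℕ+, (μ K).real (convergenceEvent bestResponses (Z K) (X K)) ≤
            1 / (K : ℝ) + √(Real.pi / (K : ℝ))) ∧
      -- better-response dynamics
      (∀ X : ∀ K : ℕ+, ℕ → Ω K → Profile (K : ℕ),
        (∀ K, IsResponseDynamics betterResponses (μ K) (Z K) (X K)) →
          (∀ K : ℕ+, |(μ K).real (convergenceEvent betterResponses (Z K) (X K)) -
            (1 - Real.exp (-1))| ≤ C / (K : ℝ)) ∧
          Tendsto (fun K => (cond (μ K) (pneEvent (Z K))).real
            (convergenceEvent betterResponses (Z K) (X K))) atTop (𝓝 1))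
    := by
  have hdiv : ∀ c : ℝ, Tendsto (fun K : ℕ+ => c / ((K : ℕ) : ℝ)) atTop (𝓝 0) := fun c =>
    (tendsto_const_div_atTop_nhds_zero_nat c).comp tendsto_PNat_val_atTop_atTop
  refine ⟨8, fun Ω _ μ _ Z hZ => ⟨fun X hX => ?_, fun X hX => ?_⟩⟩
  · have hle := fun K : ℕ+ => measureReal_convergenceEvent_bestResponses_le (hZ K) (hX K)
    refine ⟨?_, hle⟩
    have hlim : Tendsto (fun K : ℕ+ => 1 - (1 / ((K : ℕ) : ℝ) + √(Real.pi / ((K : ℕ) : ℝ))))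
        atTop (𝓝 1) := by
      have h := ((hdiv 1).add (hdiv Real.pi).sqrt).const_sub 1
      simpa using h
    refine tendsto_of_tendsto_of_tendsto_of_le_of_le hlim tendsto_const_nhds (fun K => ?_)
      fun K => measureReal_le_one
    dsimp only
    rw [probReal_compl_eq_one_sub ((hX K).measurableSet_convergenceEvent
      measurableSet_bestResponses_eq (hZ K).measurable_payoffs)]
    exact sub_le_sub_left (hle K) 1
  · refine ⟨fun K => abs_measureReal_convergenceEvent_betterResponses_sub_le (hZ K) (hX K), ?_⟩
    have hlim : Tendsto (fun K : ℕ+ => 1 - 16 / ((K : ℕ) : ℝ)) atTop (𝓝 1) := by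
      simpa using (hdiv 16).const_sub 1
    exact tendsto_of_tendsto_of_tendsto_of_le_of_le hlim tendsto_const_nhds
      (fun K => one_sub_le_cond_real_convergenceEvent (hZ K) (hX K)) fun K => measureReal_le_one
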